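/- \textbf{Setting.} Let $V$ be a finite set of word tokens, $C$ a finite set of $N_c=|C|\ge 2$ cluster tokens, $c:V\to C$ a map, and $m$ a mask token. Let $\alpha,\beta_{c},\beta_{m}$ (written $\alpha_t,\beta_{t,c},\beta_{t,m}$) be continuous on $[0,1]$ and $C^1$ and positive on $(0,1)$, with $\alpha_t+\beta_{t,c}+\beta_{t,m}=1$, $\alpha_0=1$, $\beta_{1,m}=1$, and $\alpha_t'\le 0$, $\beta_{t,m}'\ge 0$ on $(0,1)$. Let $0<\xi<1$, and put $\tilde\Gamma_\xi(k,v)=\xi$ if $k=c(v)$ and $\tilde\Gamma_\xi(k,v)=\frac{1-\xi}{N_c-1}$ otherwise. The forward marginals on $V\sqcup C\sqcup\{m\}$ are $q_t(v|x)=\alpha_t\mathbf 1[v=x]$ for $v\in V$, $q_t(k|x)=\beta_{t,c}\tilde\Gamma_\xi(k,x)$ for $k\in C$, and $q_t(m|x)=\beta_{t,m}$. The forward generator $Q_t(a,b)$ (rate from $a$ to $b$) has the entries $Q_t(v,v)=\frac{\alpha_t'}{\alpha_t}$, $Q_t(v,k)=-\frac{\alpha_t'}{\alpha_t}\tilde\Gamma_\xi(k,v)$,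 $Q_t(k,k)=\frac{\alpha_t'+\beta_{t,c}'}{\beta_{t,c}}$, $Q_t(k,m)=-\frac{\alpha_t'+\beta_{t,c}'}{\beta_{t,c}}$ ($v\in V$, $k\in C$), all others being $0$. A model $\mathbf x_\theta(z,t)$, measurable in $t$, gives for each state $z$ and time $t$ a probability vector $p_\theta(\cdot)$ on $V$; put $p_\theta(k)=\sum_{v:\,c(v)=k}p_\theta(v)$ for $k\in C$, and $q_t(z|\mathbf x_\theta)=\sum_{v}p_\theta(v)\,q_t(z|v)$. Below, $p_\theta$ is always evaluated at the current state $z_t$ and time $t$. The reverse generator is $$\hat Q_t(z_t,z_s)=-\delta_{z_s,z_t}\sum_{z'}Q_t(z',z_t)\frac{q_t(z'|\mathbf x_\theta)}{q_t(z_t|\mathbf x_\theta)}+Q_t(z_s,z_t)\frac{q_t(z_s|\mathbf x_\theta)}{q_t(z_t|\mathbf x_\theta)},$$ with the convention that a quotient with denominator $0$ is $0$. A reverse law is a family $(p_t)_{t\in[0,1]}$ of probability vectors on $V\sqcup C\sqcup\{m\}$, continuous in $t$, with $p_1=\delta_m$ and, for $0<s\le t<1$, $p_s(z)-p_t(z)=\int_s^t\sum_{z'}p_u(z')\hat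 Q_u(z',z)\,du$ with integrable integrand. The model likelihood is $p(x)=p_0(x)$. \textbf{Theorem.} Fix $x\in V$ such that $\mathbf x_\theta(z,t)$ gives $x$ positive probability for all $t\in(0,1)$ and all $z\in C\cup\{m\}$. Let $t$ be uniform on $(0,1)$ and $z_t\sim q_t(\cdot|x)$. Then a reverse law exists, and for every reverse law \begin{align*} \log p(x)\ge \mathbb E_{t,z_t}\Bigg[&\delta_{z_t,m}\frac{\beta_{t,m}'}{\beta_{t,m}}\bigg(\xi\log\Big(p_\theta(c(x))+\tfrac{1-\xi}{\xi(N_c-1)}[1-p_\theta(c(x))]\Big)\\ &\qquad+\frac{1-\xi}{N_c-1}\sum_{k\in C\setminus\{c(x)\}}\log\Big(\tfrac{\xi(N_c-1)}{1-\xi}p_\theta(k)+[1-p_\theta(k)]\Big)\bigg)\\ &+\delta_{z_t,c(x)}\frac{-\alpha_t'}{\beta_{t,c}}\log\frac{p_\theta(x)}{p_\theta(z_t)+\frac{1-\xi}{\xi(N_c-1)}[1-p_\theta(z_t)]}\\ &+\mathbf 1[z_t\in C\setminus\{c(x)\}]\frac{-\alpha_t'}{\beta_{t,c}}\log\frac{p_\theta(x)}{\frac{\xi(N_c-1)}{1-\xi}p_\theta(z_t)+[1-p_\theta(z_t)]}\Bigg].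 \end{align*} The integrand on the right is $\le 0$, so that the expectation makes sense in $[-\infty,0]$. Moreover: (a) The right-hand side is the continuous-time ELBO of the process, $$\mathbb E_{t,z_t}\Big[\sum_{z_s\ne z_t}Q_t(z_s,z_t)\frac{q_t(z_s|x)}{q_t(z_t|x)}\log\frac{\hat Q_t(z_t,z_s)\,q_t(z_t|x)}{Q_t(z_s,z_t)\,q_t(z_s|x)}+\hat Q_t(z_t,z_t)-Q_t(z_t,z_t)\Big],$$ where terms with a factor $0$ are $0$, and the expectation is the integral over $t$ of the mean over $z_t$; the two means over $z_t$ agree for every $t\in(0,1)$. (b) With $\eta=\frac{(N_c-1)\xi}{1-\xi}$, the integrand equals \begin{align*} &\delta_{z_t,m}\frac{\beta_{t,m}'}{\beta_{t,m}}\xi\bigg(\log\Big((1-\tfrac1\eta)p_\theta(c(x))+\tfrac1\eta\Big)+\frac1\eta\sum_{k\in C\setminus\{c(x)\}}\log\big((\eta-1)p_\theta(k)+1\big)\bigg)\\ &+\delta_{z_t,c(x)}\frac{-\alpha_t'}{\beta_{t,c}}\log\frac{p_\theta(x)}{(1-\frac1\eta)p_\theta(z_t)+\frac1\eta}+\mathbf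 1[z_t\in C\setminus\{c(x)\}]\frac{-\alpha_t'}{\beta_{t,c}}\log\frac{p_\theta(x)}{(\eta-1)p_\theta(z_t)+1}. \end{align*} (c) For $\xi=1$ (where $q_t(k|x)=0$ for $k\in C\setminus\{c(x)\}$, and terms with a factor $1-\xi=0$ are read as $0$), the right-hand side becomes the standard ELBO $$\mathbb E_{t,z_t}\bigg[\mathbf 1[z_t\in C]\frac{-\alpha_t'}{\beta_{t,c}}\log\frac{p_\theta(x)}{p_\theta(c(x))}+\delta_{z_t,m}\frac{\beta_{t,m}'}{\beta_{t,m}}\log p_\theta(c(x))\bigg],$$ where $z_t$ has the law $\alpha_t\delta_x+\beta_{t,c}\delta_{c(x)}+\beta_{t,m}\delta_m$. Moreover, for every fixed $t\in(0,1)$, the mean over $z_t$ of the integrand of the theorem tends to the mean over $z_t$ of this one as $\xi\uparrow1$. -/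

import Mathlib

open MeasureTheory Set Filter Topology

namespace HDLM

/-- The state space: word tokens, cluster tokens and the mask token. -/
abbrev State (V C : Type*) := V ⊕ C ⊕ Unit

variable {V C : Type*}

/-- The state of a word token. -/
abbrev word (v : V) : State V C := Sum.inl v

/-- The state of a cluster token. -/
abbrev cluster (k : C) : State V C := Sum.inr (Sum.inl k)

/-- The mask state. -/
abbrev mask : State V C := Sum.inr (Sum.inr ())

/-- A noise schedule: `α t`, `βc t`, `βm t` are the probabilities that a token is at time `t`
at the word level, at the cluster level, and masked. -/
structure Schedule where
  α : ℝ → ℝ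
  βc : ℝ → ℝ
  βm : ℝ → ℝ
  continuousOn_α : ContinuousOn α (Icc 0 1)
  continuousOn_βc : ContinuousOn βc (Icc 0 1)
  continuousOn_βm : ContinuousOn βm (Icc 0 1)
  contDiffOn_α : ContDiffOn ℝ 1 α (Ioo 0 1)
  contDiffOn_βc : ContDiffOn ℝ 1 βc (Ioo 0 1)
  contDiffOn_βm : ContDiffOn ℝ 1 βm (Ioo 0 1)
  sum_eq_one : ∀ t ∈ Icc (0 : ℝ) 1, α t + βc t + βm t = 1
  α_pos : ∀ t ∈ Ioo (0 : ℝ) 1, 0 < α t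
  βc_pos : ∀ t ∈ Ioo (0 : ℝ) 1, 0 < βc t
  βm_pos : ∀ t ∈ Ioo (0 : ℝ) 1, 0 < βm t
  α_zero : α 0 = 1
  βm_one : βm 1 = 1
  deriv_α_nonpos : ∀ t ∈ Ioo (0 : ℝ) 1, deriv α t ≤ 0
  deriv_βm_nonneg : ∀ t ∈ Ioo (0 : ℝ) 1, 0 ≤ deriv βm t

noncomputable section

variable [Fintype V] [DecidableEq V] [Fintype C] [DecidableEq C]

/-- The perturbed cluster matrix: entry `(k, v)` is the probability that the word `v` is
sent to the cluster `k`, namely `ξ` for the correct cluster `cl v` and `(1 - ξ) / (N_c - 1)` for each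
of the others. -/
def gammaPert (cl : V → C) (ξ : ℝ) (k : C) (v : V) : ℝ :=
  if k = cl v then ξ else (1 - ξ) / ((Fintype.card C : ℝ) - 1)

/-- The forward marginal `q_t(z | x)`. -/
def marginal (S : Schedule) (cl : V → C) (ξ t : ℝ) (x : V) : State V C → ℝ
  | Sum.inl v => if v = x then S.α t else 0
  | Sum.inr (Sum.inl k) => S.βc t * gammaPert cl ξ k x
  | Sum.inr (Sum.inr ()) => S.βm t

/-- `q_t(z | y) = ∑ v, y v * q_t(z | v)` for a vector `y` of word probabilities. -/
def marginalMix (S : Schedule) (cl : V → C) (ξ t : ℝ) (y : V → ℝ) (z : State V C) : ℝ :=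
  ∑ v, y v * marginal S cl ξ t v z

/-- The forward generator: `rate S cl ξ t a b` is the rate `Q_t(a, b)` of going from `a` to `b`. -/
def rate (S : Schedule) (cl : V → C) (ξ t : ℝ) : State V C → State V C → ℝ
  | Sum.inl v, Sum.inl w => if v = w then deriv S.α t / S.α t else 0
  | Sum.inl v, Sum.inr (Sum.inl k) => -(deriv S.α t / S.α t) * gammaPert cl ξ k v
  | Sum.inl _, Sum.inr (Sum.inr ()) => 0
  | Sum.inr (Sum.inl _), Sum.inl _ => 0
  | Sum.inr (Sum.inl k), Sum.inr (Sum.inl l) =>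
      if k = l then (deriv S.α t + deriv S.βc t) / S.βc t else 0
  | Sum.inr (Sum.inl _), Sum.inr (Sum.inr ()) => -((deriv S.α t + deriv S.βc t) / S.βc t)
  | Sum.inr (Sum.inr ()), _ => 0

/-- The backward generator `Q̂_t(a, b)` of the model, from `a` (at time `t`) to `b` (just before `t`).
The prediction in state `a` at time `t` is the vector `xθ t a` of word probabilities. -/
def backRate (S : Schedule) (cl : V → C) (ξ : ℝ) (xθ : ℝ → State V C → V → ℝ) (t : ℝ)
    (a b : State V C) : ℝ :=
  -(if b = a then
      ∑ z', rate S cl ξ t z' a *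
        (marginalMix S cl ξ t (xθ t a) z' / marginalMix S cl ξ t (xθ t a) a) else 0)
    + rate S cl ξ t b a *
        (marginalMix S cl ξ t (xθ t a) b / marginalMix S cl ξ t (xθ t a) a)

/-- `p` is the family of one-time laws of the reverse (generative) Markov chain, which is run from time
`1` down to time `0`, starts in the mask and jumps with the rates `backRate`: the master equation
`-(d/dt) p_t(z) = ∑ z', p_t(z') Q̂_t(z', z)` holds on `(0, 1)` in integrated form. Then `p 0 (word x)`
is the likelihood that the model gives to the word `x`. -/
structure IsReverseLaw (S : Schedule) (cl : V → C) (ξ : ℝ) (xθ : ℝ → State V C → V → ℝ)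
    (p : ℝ → State V C → ℝ) : Prop where
  nonneg : ∀ t ∈ Icc (0 : ℝ) 1, ∀ z, 0 ≤ p t z
  sum_eq_one : ∀ t ∈ Icc (0 : ℝ) 1, ∑ z, p t z = 1
  start : ∀ z, p 1 z = if z = mask then 1 else 0
  continuousOn : ∀ z, ContinuousOn (fun t => p t z) (Icc 0 1)
  integrable : ∀ s t : ℝ, 0 < s → s ≤ t → t < 1 → ∀ z,
    IntervalIntegrable (fun u => ∑ z', p u z' * backRate S cl ξ xθ u z' z) volume s t
  master : ∀ s t : ℝ, 0 < s → s ≤ t → t < 1 → ∀ z,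
    p s z - p t z = ∫ u in s..t, ∑ z', p u z' * backRate S cl ξ xθ u z' z

/-- The expectation `E_{t, z_t} [f t z_t]` with `t` uniform on `(0, 1)` and, given `t`, `z_t` of
law `q t`, as an extended real number: the integral over `t` of the positive part of the
inner mean, minus that of the negative part. -/
def extMean (q f : ℝ → State V C → ℝ) : EReal :=
  ((∫⁻ t in Ioo (0 : ℝ) 1, ENNReal.ofReal (∑ z, q t z * f t z) : ENNReal) : EReal)
    - ((∫⁻ t in Ioo (0 : ℝ) 1, ENNReal.ofReal (-∑ z, q t z * f t z) : ENNReal) : EReal)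

/-- The integrand of the continuous-time ELBO of a Markov diffusion in terms of its forward and backward
rates, in the state `z` at time `t`. -/
def rateElboTerm (S : Schedule) (cl : V → C) (ξ : ℝ) (xθ : ℝ → State V C → V → ℝ) (x : V)
    (t : ℝ) (z : State V C) : ℝ :=
  (∑ zs ∈ Finset.univ.erase z,
      rate S cl ξ t zs z * (marginal S cl ξ t x zs / marginal S cl ξ t x z) *
        Real.log (backRate S cl ξ xθ t z zs * marginal S cl ξ t x z /
          (rate S cl ξ t zs z * marginal S cl ξ t x zs)))
    + backRate S cl ξ xθ t z z - rate S cl ξ t z z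

/-- The predicted mass `p_θ(k)` of a cluster, for the vector `y` of predicted word probabilities. -/
def clusterMass (cl : V → C) (y : V → ℝ) (k : C) : ℝ :=
  ∑ v with cl v = k, y v

/-- The integrand of the closed form, in the state `z` at time `t`. -/
def closedTerm (S : Schedule) (cl : V → C) (ξ : ℝ) (xθ : ℝ → State V C → V → ℝ) (x : V)
    (t : ℝ) : State V C → ℝ
  | Sum.inl _ => 0
  | Sum.inr (Sum.inl k) =>
      let y := xθ t (cluster k)
      let pk := clusterMass cl y k
      let N : ℝ := Fintype.card C
      if k = cl x then
        -deriv S.α t / S.βc t * Real.log (y x / (pk + (1 - ξ) / (ξ * (N - 1)) * (1 - pk)))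
      else
        -deriv S.α t / S.βc t * Real.log (y x / (ξ * (N - 1) / (1 - ξ) * pk + (1 - pk)))
  | Sum.inr (Sum.inr ()) =>
      let pc : C → ℝ := clusterMass cl (xθ t mask)
      let N : ℝ := Fintype.card C
      deriv S.βm t / S.βm t *
        (ξ * Real.log (pc (cl x) + (1 - ξ) / (ξ * (N - 1)) * (1 - pc (cl x)))
          + (1 - ξ) / (N - 1) * ∑ k ∈ Finset.univ.erase (cl x),
              Real.log (ξ * (N - 1) / (1 - ξ) * pc k + (1 - pc k)))

/-- The integrand of the closed form written with a parameter `η` that stands for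
`(N_c - 1) ξ / (1 - ξ)`. -/
def closedTermEta (S : Schedule) (cl : V → C) (ξ η : ℝ) (xθ : ℝ → State V C → V → ℝ) (x : V)
    (t : ℝ) : State V C → ℝ
  | Sum.inl _ => 0
  | Sum.inr (Sum.inl k) =>
      let y := xθ t (cluster k)
      let pk := clusterMass cl y k
      if k = cl x then
        -deriv S.α t / S.βc t * Real.log (y x / ((1 - 1 / η) * pk + 1 / η))
      else
        -deriv S.α t / S.βc t * Real.log (y x / ((η - 1) * pk + 1))
  | Sum.inr (Sum.inr ()) =>
      let pc : C → ℝ := clusterMass cl (xθ t mask)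
      deriv S.βm t / S.βm t * ξ *
        (Real.log ((1 - 1 / η) * pc (cl x) + 1 / η)
          + 1 / η * ∑ k ∈ Finset.univ.erase (cl x), Real.log ((η - 1) * pc k + 1))

/-- The forward marginal of the process without perturbations: word `x`, cluster `cl x`, mask. -/
def stdMarginal (S : Schedule) (cl : V → C) (t : ℝ) (x : V) : State V C → ℝ
  | Sum.inl v => if v = x then S.α t else 0
  | Sum.inr (Sum.inl k) => if k = cl x then S.βc t else 0
  | Sum.inr (Sum.inr ()) => S.βm t

/-- The integrand of the closed-form ELBO of the process without perturbations. -/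
def stdTerm (S : Schedule) (cl : V → C) (xθ : ℝ → State V C → V → ℝ) (x : V)
    (t : ℝ) : State V C → ℝ
  | Sum.inl _ => 0
  | Sum.inr (Sum.inl k) =>
      -deriv S.α t / S.βc t *
        Real.log (xθ t (cluster k) x / clusterMass cl (xθ t (cluster k)) (cl x))
  | Sum.inr (Sum.inr ()) =>
      deriv S.βm t / S.βm t * Real.log (clusterMass cl (xθ t mask) (cl x))

/-- The closed-form ELBO with perturbation parameter `ξ`. -/
def closedElbo (S : Schedule) (cl : V → C) (ξ : ℝ) (xθ : ℝ → State V C → V → ℝ) (x : V) : EReal :=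
  extMean (fun t => marginal S cl ξ t x) (closedTerm S cl ξ xθ x)

/-- The closed-form ELBO in terms of `η`. -/
def closedElboEta (S : Schedule) (cl : V → C) (ξ η : ℝ) (xθ : ℝ → State V C → V → ℝ) (x : V) :
    EReal :=
  extMean (fun t => marginal S cl ξ t x) (closedTermEta S cl ξ η xθ x)

/-- The continuous-time ELBO in terms of rates. -/
def rateElbo (S : Schedule) (cl : V → C) (ξ : ℝ) (xθ : ℝ → State V C → V → ℝ) (x : V) : EReal :=
  extMean (fun t => marginal S cl ξ t x) (rateElboTerm S cl ξ xθ x)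

/-- The closed-form ELBO without perturbations. -/
def stdElbo (S : Schedule) (cl : V → C) (xθ : ℝ → State V C → V → ℝ) (x : V) : EReal :=
  extMean (fun t => stdMarginal S cl t x) (stdTerm S cl xθ x)

end

end HDLM

/-! The lower bound is proved without path measures. The mean of the integrand at time `t` is at
most the derivative of an explicit function `Ψ` of the one-time laws of the reverse chain, and `Ψ`
increases by exactly `log P` over `(0, 1)`, where `P = p_0(x)`.

In reverse time words are absorbing. A cluster `k` is left at total rate `r = -α' / βc`, the new
word being drawn from the predicted posterior given `k`. The mask is left at rate `βm' / βm`, the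
cluster being drawn with probabilities `G_k = ∑ v, p_θ(v) Γ(k, v)`. Writing `R_k` for the predicted
posterior of `x` given `k`, the mean of the integrand is `-α' ∑ Γ(k, x) log R_k + βm' ∑ Γ(k, x) log
(G_k / Γ(k, x))`.

Let `w_k = p_t(k) / (βc Γ(k, x))` compare reverse and forward cluster probabilities. Apply `log r ≤
r - 1` to `w_k R_k / P` and to `G_k / (Γ(k, x) w_k)` (`elbo_summand_le`). The total coefficient of
`log w_k` is `(α' + βm') Γ(k, x) = -βc' Γ(k, x)`, so these terms and the second remainder form
`-Γ(k, x) (βc log w_k)'`; the terms `w_k R_k` add up to the flow of the chain into `x`, which is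
`-p_t(x)'`. Hence `Ψ = (1 - log P) α - p_t(x) / P - ∑ Γ(k, x) βc log w_k` (`elboDensity_le`).

For the boundary values, `βc log w_k` vanishes at both ends because `w_k` stays between positive
constants: `p_t(k)` solves `f' = r f - βm' G_k`, while `βc` solves the same equation with source
`βm'`, so a comparison principle applies (`cluster_mem_Icc`). That `P` is positive is
`word_zero_pos`.

The model is only measurable in time, so reverse laws are only locally absolutely continuous;
`HasIntDeriv` supplies the calculus. Existence is explicit because the master equation is
triangular: mask, then clusters by variation of constants, then words by integrating the flow. The
remaining claims are identities at a fixed time and an elementary limit. -/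

namespace HDLM

/-! ### Calculus of locally absolutely continuous functions on `(0, 1)`. -/

/-- `f` is locally absolutely continuous on `(0, 1)` with derivative `h`: the increments of `f` on
compact subintervals are the integrals of `h`. -/
def HasIntDeriv (f h : ℝ → ℝ) : Prop :=
  ∀ s t : ℝ, 0 < s → s ≤ t → t < 1 →
    IntervalIntegrable h volume s t ∧ ∫ u in s..t, h u = f t - f s

namespace HasIntDeriv

variable {f g h k : ℝ → ℝ}

theorem congr (hf : HasIntDeriv f h) (hg : ∀ t ∈ Ioo (0 : ℝ) 1, f t = g t)
    (hk : ∀ t ∈ Ioo (0 : ℝ) 1, h t = k t) : HasIntDeriv g k := by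
  intro s t hs hst ht
  obtain ⟨h1, h2⟩ := hf s t hs hst ht
  have hsub : ∀ u ∈ uIcc s t, u ∈ Ioo (0 : ℝ) 1 := by
    rw [uIcc_of_le hst]; intro u hu; exact ⟨hs.trans_le hu.1, hu.2.trans_lt ht⟩
  refine ⟨h1.congr fun u hu => hk u (hsub u (uIoc_subset_uIcc hu)), ?_⟩
  rw [← hg s (hsub s left_mem_uIcc), ← hg t (hsub t right_mem_uIcc), ← h2]
  exact intervalIntegral.integral_congr fun u hu => (hk u (hsub u hu)).symm

theorem of_hasDerivAt (hd : ∀ t ∈ Ioo (0 : ℝ) 1, HasDerivAt f (h t) t)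
    (hc : ContinuousOn h (Ioo 0 1)) : HasIntDeriv f h := by
  intro s t hs hst ht
  have hsub : uIcc s t ⊆ Ioo (0 : ℝ) 1 := by
    rw [uIcc_of_le hst]; intro u hu; exact ⟨hs.trans_le hu.1, hu.2.trans_lt ht⟩
  have hi : IntervalIntegrable h volume s t := (hc.mono hsub).intervalIntegrable
  exact ⟨hi, intervalIntegral.integral_eq_sub_of_hasDerivAt (fun u hu => hd u (hsub hu)) hi⟩

theorem sub (hf : HasIntDeriv f h) (hg : HasIntDeriv g k) :
    HasIntDeriv (fun t => f t - g t) (fun t => h t - k t) := by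
  intro s t hs hst ht
  obtain ⟨h1, h2⟩ := hf s t hs hst ht
  obtain ⟨k1, k2⟩ := hg s t hs hst ht
  refine ⟨h1.sub k1, ?_⟩
  rw [intervalIntegral.integral_sub h1 k1, h2, k2]
  ring

theorem const_mul (c : ℝ) (hf : HasIntDeriv f h) :
    HasIntDeriv (fun t => c * f t) (fun t => c * h t) := by
  intro s t hs hst ht
  obtain ⟨h1, h2⟩ := hf s t hs hst ht
  refine ⟨h1.const_mul c, ?_⟩
  rw [intervalIntegral.integral_const_mul, h2]
  ring

theorem sum {ι : Type*} (T : Finset ι) {f h : ι → ℝ → ℝ} (hf : ∀ i, HasIntDeriv (f i) (h i)) :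
    HasIntDeriv (fun t => ∑ i ∈ T, f i t) (fun t => ∑ i ∈ T, h i t) := by
  intro s t hs hst ht
  have h1 := fun i => (hf i s t hs hst ht).1
  refine ⟨by simpa [Finset.sum_fn] using IntervalIntegrable.sum T (fun i _ => h1 i), ?_⟩
  rw [intervalIntegral.integral_finsetSum (fun i _ => h1 i), ← Finset.sum_sub_distrib]
  exact Finset.sum_congr rfl fun i _ => (hf i s t hs hst ht).2

theorem le_of_nonpos (hf : HasIntDeriv f h) (hh : ∀ t ∈ Ioo (0 : ℝ) 1, h t ≤ 0)
    {s t : ℝ} (hs : 0 < s) (hst : s ≤ t) (ht : t < 1) : f t ≤ f s := by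
  obtain ⟨h1, h2⟩ := hf s t hs hst ht
  have : ∫ u in s..t, h u ≤ ∫ u in s..t, (0 : ℝ) :=
    intervalIntegral.integral_mono_on hst h1 (by simp) fun u hu =>
      hh u ⟨hs.trans_le hu.1, hu.2.trans_lt ht⟩
  simp only [intervalIntegral.integral_zero] at this
  linarith

/-- The representation of `f` as a primitive on `[s, t]`, with its almost everywhere derivative. -/
theorem exists_primitive (hf : HasIntDeriv f h) {s t : ℝ} (hs : 0 < s) (hst : s ≤ t) (ht : t < 1) :
    ∃ F : ℝ → ℝ, AbsolutelyContinuousOnInterval F s t ∧ (∀ u ∈ Icc s t, F u = f u) ∧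
      ∀ᵐ u, u ∈ uIoc s t → HasDerivAt F (h u) u := by
  obtain ⟨h1, h2⟩ := hf s t hs hst ht
  refine ⟨fun u => (∫ v in s..u, h v) + f s, ?_, ?_, ?_⟩
  · have hc : AbsolutelyContinuousOnInterval (fun _ : ℝ => f s) s t :=
      (contDiffOn_const (c := f s)).absolutelyContinuousOnInterval
    exact (h1.absolutelyContinuousOnInterval_intervalIntegral left_mem_uIcc).fun_add hc
  · intro u hu
    dsimp only
    rw [(hf s u hs hu.1 (hu.2.trans_lt ht)).2]
    ring
  · filter_upwards [h1.ae_hasDerivAt_integral] with u hu hu'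
    exact (hu (uIoc_subset_uIcc hu') s left_mem_uIcc).add_const _

theorem continuousOn (hf : HasIntDeriv f h) : ContinuousOn f (Ioo 0 1) := by
  intro u hu
  obtain ⟨s, hs, hsu⟩ := exists_between hu.1
  obtain ⟨t, hut, ht⟩ := exists_between hu.2
  obtain ⟨F, hF, hFf, -⟩ := hf.exists_primitive hs (hsu.trans hut).le ht
  have hc : ContinuousOn F (Icc s t) := by
    simpa [uIcc_of_le (hsu.trans hut).le] using hF.continuousOn
  have : ContinuousOn f (Icc s t) := hc.congr fun v hv => (hFf v hv).symm
  exact (this.continuousAt (Icc_mem_nhds hsu hut)).continuousWithinAt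

/-- The increments of an absolutely continuous function `F` are the integrals of its almost
everywhere derivative. -/
theorem _root_.AbsolutelyContinuousOnInterval.integral_eq_sub_of_ae_hasDerivAt
    {F h : ℝ → ℝ} {s t : ℝ} (hF : AbsolutelyContinuousOnInterval F s t)
    (hd : ∀ᵐ u, u ∈ uIoc s t → HasDerivAt F (h u) u) :
    IntervalIntegrable h volume s t ∧ ∫ u in s..t, h u = F t - F s := by
  have he : ∀ᵐ u, u ∈ uIoc s t → deriv F u = h u := by
    filter_upwards [hd] with u hu hu'
    exact (hu hu').deriv
  refine ⟨hF.intervalIntegrable_deriv.congr_ae ?_, ?_⟩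
  · rwa [Filter.EventuallyEq, ae_restrict_iff' measurableSet_uIoc]
  · rw [← hF.integral_deriv_eq_sub]
    exact (intervalIntegral.integral_congr_ae he).symm

/-- Absolute continuity is stable under products, so the product rule is needed only almost
everywhere, at common differentiability points of the two primitives. -/
theorem mul (hf : HasIntDeriv f h) (hg : HasIntDeriv g k) :
    HasIntDeriv (fun t => f t * g t) (fun t => h t * g t + f t * k t) := by
  intro s t hs hst ht
  obtain ⟨F, hF, hFf, hFd⟩ := hf.exists_primitive hs hst ht
  obtain ⟨G, hG, hGg, hGd⟩ := hg.exists_primitive hs hst ht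
  dsimp only
  rw [← hFf t ⟨hst, le_rfl⟩, ← hGg t ⟨hst, le_rfl⟩, ← hFf s ⟨le_rfl, hst⟩,
    ← hGg s ⟨le_rfl, hst⟩]
  refine (hF.fun_mul hG).integral_eq_sub_of_ae_hasDerivAt ?_
  filter_upwards [hFd, hGd] with u h1 h2 hu
  have hu' : u ∈ Icc s t := by
    rw [← uIcc_of_le hst]; exact uIoc_subset_uIcc hu
  rw [← hFf u hu', ← hGg u hu']
  exact (h1 hu).mul (h2 hu)

theorem _root_.LipschitzOnWith.comp_absolutelyContinuousOnInterval {φ F : ℝ → ℝ} {K : NNReal}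
    {S : Set ℝ} {s t : ℝ} (hφ : LipschitzOnWith K φ S) (hF : AbsolutelyContinuousOnInterval F s t)
    (hS : ∀ u ∈ uIcc s t, F u ∈ S) :
    AbsolutelyContinuousOnInterval (fun u => φ (F u)) s t := by
  rw [absolutelyContinuousOnInterval_iff] at hF ⊢
  intro ε hε
  obtain ⟨δ, hδ, H⟩ := hF (ε / (K + 1)) (by positivity)
  refine ⟨δ, hδ, fun E hE hE' => ?_⟩
  have h1 : ∑ i ∈ Finset.range E.1, dist (φ (F (E.2 i).1)) (φ (F (E.2 i).2)) ≤
      ∑ i ∈ Finset.range E.1, K * dist (F (E.2 i).1) (F (E.2 i).2) :=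
    Finset.sum_le_sum fun i hi =>
      hφ.dist_le_mul _ (hS _ (hE.1 i hi).1) _ (hS _ (hE.1 i hi).2)
  rw [← Finset.mul_sum] at h1
  have h2 := H E hE hE'
  rw [lt_div_iff₀ (by positivity)] at h2
  have h3 : 0 ≤ ∑ i ∈ Finset.range E.1, dist (F (E.2 i).1) (F (E.2 i).2) :=
    Finset.sum_nonneg fun _ _ => dist_nonneg
  nlinarith

/-- On a compact subinterval the values fill at most a compact subset of `(0, ∞)`, where `Real.log`
is Lipschitz; Lipschitz maps preserve absolute continuity. -/
theorem log (hf : HasIntDeriv f h) (hpos : ∀ t ∈ Ioo (0 : ℝ) 1, 0 < f t) :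
    HasIntDeriv (fun t => Real.log (f t)) (fun t => h t / f t) := by
  intro s t hs hst ht
  obtain ⟨F, hF, hFf, hFd⟩ := hf.exists_primitive hs hst ht
  have hFpos : ∀ u ∈ Icc s t, 0 < F u := fun u hu => by
    rw [hFf u hu]; exact hpos u ⟨hs.trans_le hu.1, hu.2.trans_lt ht⟩
  have hFc : ContinuousOn F (Icc s t) := by simpa [uIcc_of_le hst] using hF.continuousOn
  obtain ⟨lo, hlo, hmin⟩ := isCompact_Icc.exists_isMinOn (nonempty_Icc.2 hst) hFc
  obtain ⟨hi, hhi, hmax⟩ := isCompact_Icc.exists_isMaxOn (nonempty_Icc.2 hst) hFc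
  have hlog : ContDiffOn ℝ 1 Real.log (Icc (F lo) (F hi)) :=
    Real.contDiffOn_log.of_le (by exact_mod_cast le_top) |>.mono fun u hu =>
      ((hFpos lo hlo).trans_le hu.1).ne'
  obtain ⟨K, hK⟩ := hlog.exists_lipschitzOnWith (by decide) (convex_Icc _ _) isCompact_Icc
  have hac := hK.comp_absolutelyContinuousOnInterval hF (fun u hu => by
    rw [uIcc_of_le hst] at hu
    exact ⟨hmin hu, hmax hu⟩)
  dsimp only
  rw [← hFf t ⟨hst, le_rfl⟩, ← hFf s ⟨le_rfl, hst⟩]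
  refine hac.integral_eq_sub_of_ae_hasDerivAt ?_
  filter_upwards [hFd] with u h1 hu
  have hu' : u ∈ Icc s t := by
    rw [← uIcc_of_le hst]; exact uIoc_subset_uIcc hu
  rw [← hFf u hu']
  exact (h1 hu).log (hFpos u hu').ne'

end HasIntDeriv

/-! ### Rates and integrands at a fixed time. -/

section Algebra

variable {V C : Type*} [Fintype V] [DecidableEq V] [Fintype C] [DecidableEq C]
variable {S : Schedule} {cl : V → C} {ξ t : ℝ} {xθ : ℝ → State V C → V → ℝ} {x : V}

omit [DecidableEq V] [DecidableEq C] in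
theorem sum_state (f : State V C → ℝ) :
    ∑ z, f z = ∑ v, f (word v) + (∑ k, f (cluster k) + f mask) := by
  simp [Fintype.sum_sum_type]

/-- The probability of the cluster `k` under the perturbed cluster matrix, for a random word with
probabilities `y`. -/
noncomputable def gammaMix (cl : V → C) (ξ : ℝ) (k : C) (y : V → ℝ) : ℝ :=
  ∑ v, y v * gammaPert cl ξ k v

omit [DecidableEq C] in
theorem card_sub_one_pos (hC : 2 ≤ Fintype.card C) : (0 : ℝ) < (Fintype.card C : ℝ) - 1 := by
  have : (2 : ℝ) ≤ Fintype.card C := by exact_mod_cast hC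
  linarith

omit [Fintype V] [DecidableEq V] in
theorem gammaPert_pos (hC : 2 ≤ Fintype.card C) (hξ0 : 0 < ξ) (hξ1 : ξ < 1) (k : C) (v : V) :
    0 < gammaPert cl ξ k v := by
  have := card_sub_one_pos hC
  unfold gammaPert
  split_ifs
  · exact hξ0
  · exact div_pos (by linarith) this

omit [Fintype V] [DecidableEq V] in
theorem sum_gammaPert (hC : 2 ≤ Fintype.card C) (v : V) : ∑ k, gammaPert cl ξ k v = 1 := by
  have := card_sub_one_pos hC
  rw [← Finset.add_sum_erase _ _ (Finset.mem_univ (cl v))]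
  rw [Finset.sum_congr rfl (g := fun _ => (1 - ξ) / ((Fintype.card C : ℝ) - 1))
    (fun k hk => by simp [gammaPert, Finset.ne_of_mem_erase hk])]
  rw [Finset.sum_const, Finset.card_erase_of_mem (Finset.mem_univ _), Finset.card_univ, nsmul_eq_mul,
    Nat.cast_sub (by omega)]
  simp only [gammaPert, if_true]
  push_cast
  field_simp
  ring

/-- A lower bound of the entries of the perturbed cluster matrix. -/
noncomputable def gammaMin (C : Type*) [Fintype C] (ξ : ℝ) : ℝ :=
  min ξ ((1 - ξ) / ((Fintype.card C : ℝ) - 1))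

omit [DecidableEq C] in
theorem gammaMin_pos (hC : 2 ≤ Fintype.card C) (hξ0 : 0 < ξ) (hξ1 : ξ < 1) :
    0 < gammaMin C ξ :=
  lt_min hξ0 (div_pos (by linarith) (card_sub_one_pos hC))

omit [Fintype V] [DecidableEq V] in
theorem gammaMin_le (k : C) (v : V) : gammaMin C ξ ≤ gammaPert cl ξ k v := by
  unfold gammaMin gammaPert
  split_ifs
  · exact min_le_left _ _
  · exact min_le_right _ _

omit [Fintype V] [DecidableEq V] in
theorem gammaPert_le_one (hC : 2 ≤ Fintype.card C) (hξ0 : 0 < ξ) (hξ1 : ξ < 1) (k : C) (v : V) :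
    gammaPert cl ξ k v ≤ 1 := by
  rw [← sum_gammaPert (cl := cl) (ξ := ξ) hC v]
  exact Finset.single_le_sum (f := fun k => gammaPert cl ξ k v)
    (fun j _ => (gammaPert_pos hC hξ0 hξ1 j v).le) (Finset.mem_univ k)

omit [DecidableEq V] in
theorem gammaMin_le_gammaMix {y : V → ℝ} (h0 : ∀ v, 0 ≤ y v) (h1 : ∑ v, y v = 1) (k : C) :
    gammaMin C ξ ≤ gammaMix cl ξ k y := by
  calc gammaMin C ξ = ∑ v, y v * gammaMin C ξ := by rw [← Finset.sum_mul, h1, one_mul]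
    _ ≤ _ := Finset.sum_le_sum fun v _ => mul_le_mul_of_nonneg_left (gammaMin_le k v) (h0 v)

omit [DecidableEq V] in
theorem gammaMix_pos (hC : 2 ≤ Fintype.card C) (hξ0 : 0 < ξ) (hξ1 : ξ < 1)
    {y : V → ℝ} (h0 : ∀ v, 0 ≤ y v) (h1 : ∑ v, y v = 1) (k : C) : 0 < gammaMix cl ξ k y :=
  (gammaMin_pos hC hξ0 hξ1).trans_le (gammaMin_le_gammaMix h0 h1 k)

omit [DecidableEq V] in
theorem gammaMix_le_one (hC : 2 ≤ Fintype.card C) (hξ0 : 0 < ξ) (hξ1 : ξ < 1)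
    {y : V → ℝ} (h0 : ∀ v, 0 ≤ y v) (h1 : ∑ v, y v = 1) (k : C) : gammaMix cl ξ k y ≤ 1 := by
  calc _ ≤ ∑ v, y v * 1 := Finset.sum_le_sum fun v _ =>
        mul_le_mul_of_nonneg_left (gammaPert_le_one hC hξ0 hξ1 k v) (h0 v)
    _ = 1 := by rw [← Finset.sum_mul, h1, one_mul]

omit [DecidableEq V] in
theorem sum_gammaMix (hC : 2 ≤ Fintype.card C) {y : V → ℝ} (h1 : ∑ v, y v = 1) :
    ∑ k, gammaMix cl ξ k y = 1 := by
  unfold gammaMix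
  rw [Finset.sum_comm]
  simp_rw [← Finset.mul_sum, sum_gammaPert hC, mul_one, h1]

omit [DecidableEq V] in
-- Only the predicted mass of the cluster `k` matters, since `gammaPert` takes just two values; this
-- links the posterior form of the integrand to its closed form.
theorem gammaMix_eq {y : V → ℝ} (h1 : ∑ v, y v = 1) (k : C) :
    gammaMix cl ξ k y = ξ * clusterMass cl y k
      + (1 - ξ) / ((Fintype.card C : ℝ) - 1) * (1 - clusterMass cl y k) := by
  have hk : ∀ v, y v * gammaPert cl ξ k v =
      (1 - ξ) / ((Fintype.card C : ℝ) - 1) * y v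
      + (ξ - (1 - ξ) / ((Fintype.card C : ℝ) - 1)) * (if cl v = k then y v else 0) := by
    intro v
    unfold gammaPert
    by_cases h : cl v = k
    · simp only [h, if_true]; ring
    · rw [if_neg (Ne.symm h), if_neg h]; ring
  unfold gammaMix clusterMass
  simp_rw [hk]
  rw [Finset.sum_add_distrib, ← Finset.mul_sum, ← Finset.mul_sum, h1, Finset.sum_filter]
  ring

omit [DecidableEq V] in
theorem mul_gammaPert_le_gammaMix (hC : 2 ≤ Fintype.card C) (hξ0 : 0 < ξ) (hξ1 : ξ < 1)
    {y : V → ℝ} (h0 : ∀ v, 0 ≤ y v) (k : C) (v : V) :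
    y v * gammaPert cl ξ k v ≤ gammaMix cl ξ k y :=
  Finset.single_le_sum (f := fun v => y v * gammaPert cl ξ k v)
    (fun w _ => mul_nonneg (h0 w) (gammaPert_pos hC hξ0 hξ1 k w).le) (Finset.mem_univ v)

theorem marginalMix_word (y : V → ℝ) (v : V) :
    marginalMix S cl ξ t y (word v) = y v * S.α t := by
  simp [marginalMix, marginal]

theorem marginalMix_cluster (y : V → ℝ) (k : C) :
    marginalMix S cl ξ t y (cluster k) = S.βc t * gammaMix cl ξ k y := by
  simp only [marginalMix, marginal, gammaMix, Finset.mul_sum]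
  exact Finset.sum_congr rfl fun v _ => by ring

theorem marginalMix_mask {y : V → ℝ} (h1 : ∑ v, y v = 1) :
    marginalMix S cl ξ t y mask = S.βm t := by
  simp [marginalMix, marginal, ← Finset.sum_mul, h1]

theorem Schedule.hasDerivAt_α (S : Schedule) (ht : t ∈ Ioo (0 : ℝ) 1) :
    HasDerivAt S.α (deriv S.α t) t :=
  ((S.contDiffOn_α.differentiableOn one_ne_zero).differentiableAt
    (isOpen_Ioo.mem_nhds ht)).hasDerivAt

theorem Schedule.hasDerivAt_βc (S : Schedule) (ht : t ∈ Ioo (0 : ℝ) 1) :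
    HasDerivAt S.βc (deriv S.βc t) t :=
  ((S.contDiffOn_βc.differentiableOn one_ne_zero).differentiableAt
    (isOpen_Ioo.mem_nhds ht)).hasDerivAt

theorem Schedule.hasDerivAt_βm (S : Schedule) (ht : t ∈ Ioo (0 : ℝ) 1) :
    HasDerivAt S.βm (deriv S.βm t) t :=
  ((S.contDiffOn_βm.differentiableOn one_ne_zero).differentiableAt
    (isOpen_Ioo.mem_nhds ht)).hasDerivAt

theorem Schedule.sum_deriv (S : Schedule) (ht : t ∈ Ioo (0 : ℝ) 1) :
    deriv S.α t + deriv S.βc t + deriv S.βm t = 0 := by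
  have h := ((S.hasDerivAt_α ht).add (S.hasDerivAt_βc ht)).add (S.hasDerivAt_βm ht)
  refine h.unique ((hasDerivAt_const t (1 : ℝ)).congr_of_eventuallyEq ?_)
  filter_upwards [isOpen_Ioo.mem_nhds ht] with u hu
  exact S.sum_eq_one u (Ioo_subset_Icc_self hu)

/-- The rate at which the reverse process leaves a cluster state. -/
noncomputable def Schedule.wordRate (S : Schedule) (t : ℝ) : ℝ := -deriv S.α t / S.βc t

theorem Schedule.wordRate_nonneg (S : Schedule) (ht : t ∈ Ioo (0 : ℝ) 1) : 0 ≤ S.wordRate t :=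
  div_nonneg (neg_nonneg.2 (S.deriv_α_nonpos t ht)) (S.βc_pos t ht).le

theorem Schedule.wordRate_mul (S : Schedule) (ht : t ∈ Ioo (0 : ℝ) 1) :
    S.wordRate t * S.βc t = -deriv S.α t :=
  div_mul_cancel₀ _ (S.βc_pos t ht).ne'

/-- The only nonzero rate into a word comes from the word itself, and its two contributions to the
diagonal cancel. Hence words are absorbing, even where the quotient has denominator `0`. -/
theorem backRate_word (w : V) (z : State V C) :
    backRate S cl ξ xθ t (word w) z = 0 := by
  have hz : ∀ z', z' ≠ word w → rate S cl ξ t z' (word w) = 0 := by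
    rintro (v | k | ⟨⟩) h
    · have : v ≠ w := fun e => h (by rw [e])
      simp [rate, this]
    · rfl
    · rfl
  unfold backRate
  by_cases h : z = word w
  · subst h
    rw [if_pos rfl, Finset.sum_eq_single (word w) (fun b _ hb => by rw [hz b hb, zero_mul])
      (by simp)]
    ring
  · rw [if_neg h, hz z h]
    simp

/-- Bayes' rule: `α` cancels, and what multiplies the exit rate is the posterior of the word given
the cluster. -/
theorem backRate_cluster_word (ht : t ∈ Ioo (0 : ℝ) 1)
    {k : C} (v : V) : backRate S cl ξ xθ t (cluster k) (word v) = S.wordRate t *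
      (xθ t (cluster k) v * gammaPert cl ξ k v / gammaMix cl ξ k (xθ t (cluster k))) := by
  have := (S.α_pos t ht).ne'
  have := (S.βc_pos t ht).ne'
  unfold backRate Schedule.wordRate
  rw [marginalMix_word, marginalMix_cluster]
  simp only [reduceCtorEq, if_false, rate]
  field_simp
  ring

theorem backRate_cluster_cluster (hC : 2 ≤ Fintype.card C) (hξ0 : 0 < ξ) (hξ1 : ξ < 1)
    (ht : t ∈ Ioo (0 : ℝ) 1) {k : C} (h0 : ∀ v, 0 ≤ xθ t (cluster k) v)
    (h1 : ∑ v, xθ t (cluster k) v = 1) (l : C) :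
    backRate S cl ξ xθ t (cluster k) (cluster l) = if l = k then -S.wordRate t else 0 := by
  have hα := (S.α_pos t ht).ne'
  have hβ := (S.βc_pos t ht).ne'
  have hG := gammaMix_pos (cl := cl) hC hξ0 hξ1 h0 h1 k
  unfold backRate
  by_cases h : l = k
  · subst h
    simp only [if_true]
    rw [add_comm, ← sub_eq_add_neg, sum_state, ← sub_sub, Finset.sum_eq_single l
      (fun b _ hb => by simp [rate, hb]) (by simp)]
    have hs : ∑ v, rate S cl ξ t (word v) (cluster l) * (marginalMix S cl ξ t (xθ t (cluster l))
        (word v) / marginalMix S cl ξ t (xθ t (cluster l)) (cluster l)) = S.wordRate t := by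
      calc _ = ∑ v, S.wordRate t / gammaMix cl ξ l (xθ t (cluster l)) *
            (xθ t (cluster l) v * gammaPert cl ξ l v) := by
            refine Finset.sum_congr rfl fun v _ => ?_
            rw [marginalMix_word, marginalMix_cluster]
            unfold Schedule.wordRate
            simp only [rate]
            field_simp
        _ = S.wordRate t / gammaMix cl ξ l (xθ t (cluster l)) *
            gammaMix cl ξ l (xθ t (cluster l)) := by rw [← Finset.mul_sum]; rfl
        _ = _ := div_mul_cancel₀ _ hG.ne'
    rw [hs]
    simp only [rate, zero_mul, add_zero]
    ring
  · have h' : (cluster l : State V C) ≠ cluster k := by simpa using h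
    simp [rate, h]

theorem backRate_cluster_mask {k : C} :
    backRate S cl ξ xθ t (cluster k) mask = 0 := by
  simp [backRate, rate]

theorem backRate_mask_word (v : V) : backRate S cl ξ xθ t mask (word v) = 0 := by
  simp [backRate, rate]

theorem backRate_mask_cluster (ht : t ∈ Ioo (0 : ℝ) 1) (h1 : ∑ v, xθ t mask v = 1) (k : C) :
    backRate S cl ξ xθ t mask (cluster k) =
      deriv S.βm t / S.βm t * gammaMix cl ξ k (xθ t mask) := by
  have hβ := (S.βc_pos t ht).ne'
  have hs : deriv S.α t + deriv S.βc t = -deriv S.βm t := by linarith [S.sum_deriv ht]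
  unfold backRate
  rw [marginalMix_cluster, marginalMix_mask h1]
  simp only [reduceCtorEq, Sum.inr.injEq, if_false, rate, hs]
  field_simp
  ring

theorem backRate_mask_mask (hC : 2 ≤ Fintype.card C) (ht : t ∈ Ioo (0 : ℝ) 1)
    (h1 : ∑ v, xθ t mask v = 1) :
    backRate S cl ξ xθ t mask mask = -(deriv S.βm t / S.βm t) := by
  have hs : ∑ k, rate S cl ξ t (cluster k) mask * (marginalMix S cl ξ t (xθ t mask) (cluster k) /
      marginalMix S cl ξ t (xθ t mask) mask) = deriv S.βm t / S.βm t := by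
    calc _ = ∑ k, deriv S.βm t / S.βm t * gammaMix cl ξ k (xθ t mask) := by
          refine Finset.sum_congr rfl fun k _ => ?_
          rw [← backRate_mask_cluster ht h1 k]
          simp [backRate]
      _ = _ := by rw [← Finset.mul_sum, sum_gammaMix hC h1, mul_one]
  unfold backRate
  rw [if_pos rfl, sum_state, hs]
  simp [rate]

omit [DecidableEq V] in
-- Expanding the fraction by `gammaPert cl ξ k x` turns both branches, correct and wrong cluster,
-- into the logarithm of one posterior probability.
theorem closedTerm_cluster (hC : 2 ≤ Fintype.card C) (hξ0 : 0 < ξ) (hξ1 : ξ < 1) {k : C}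
    (h1 : ∑ v, xθ t (cluster k) v = 1) :
    closedTerm S cl ξ xθ x t (cluster k) = S.wordRate t * Real.log
      (xθ t (cluster k) x * gammaPert cl ξ k x / gammaMix cl ξ k (xθ t (cluster k))) := by
  have hN := card_sub_one_pos hC
  have hξ : 0 < 1 - ξ := by linarith
  rw [gammaMix_eq h1]
  simp only [closedTerm, gammaPert]
  unfold Schedule.wordRate
  split_ifs with h
  · congr 2
    rw [mul_comm (xθ t (cluster k) x), ← mul_div_mul_left _ _ hξ0.ne']
    congr 1
    field_simp
  · congr 2
    rw [mul_comm (xθ t (cluster k) x), ← mul_div_mul_left _ _ (div_pos hξ hN).ne']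
    congr 1
    field_simp

omit [DecidableEq V] in
theorem closedTerm_mask (hC : 2 ≤ Fintype.card C) (hξ0 : 0 < ξ) (hξ1 : ξ < 1)
    (h1 : ∑ v, xθ t mask v = 1) :
    closedTerm S cl ξ xθ x t mask = deriv S.βm t / S.βm t * ∑ k, gammaPert cl ξ k x *
      Real.log (gammaMix cl ξ k (xθ t mask) / gammaPert cl ξ k x) := by
  have hN := card_sub_one_pos hC
  have hξ : 0 < 1 - ξ := by linarith
  rw [← Finset.add_sum_erase _ _ (Finset.mem_univ (cl x))]
  simp only [closedTerm]
  congr 2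
  · simp only [gammaPert, if_true]
    rw [gammaMix_eq h1]
    congr 2
    field_simp
  · rw [Finset.mul_sum]
    refine Finset.sum_congr rfl fun k hk => ?_
    simp only [gammaPert, Finset.ne_of_mem_erase hk, if_false]
    rw [gammaMix_eq h1]
    congr 2
    field_simp

omit [DecidableEq V] in
-- In a cluster state the logarithm is that of a posterior probability; in the mask state the sum is
-- minus a Kullback–Leibler divergence.
theorem closedTerm_nonpos (hC : 2 ≤ Fintype.card C) (hξ0 : 0 < ξ) (hξ1 : ξ < 1)
    (ht : t ∈ Ioo (0 : ℝ) 1) (h0 : ∀ z v, 0 ≤ xθ t z v) (h1 : ∀ z, ∑ v, xθ t z v = 1)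
    (z : State V C) : closedTerm S cl ξ xθ x t z ≤ 0 := by
  obtain v | k | ⟨⟩ := z
  · exact le_rfl
  · change closedTerm S cl ξ xθ x t (cluster k) ≤ 0
    rw [closedTerm_cluster hC hξ0 hξ1 (h1 _)]
    refine mul_nonpos_of_nonneg_of_nonpos (S.wordRate_nonneg ht) (Real.log_nonpos ?_ ?_)
    · exact div_nonneg (mul_nonneg (h0 _ _) (gammaPert_pos hC hξ0 hξ1 _ _).le)
        (gammaMix_pos hC hξ0 hξ1 (h0 _) (h1 _) k).le
    · exact div_le_one_of_le₀ (mul_gammaPert_le_gammaMix hC hξ0 hξ1 (h0 _) k x)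
        (gammaMix_pos hC hξ0 hξ1 (h0 _) (h1 _) k).le
  · change closedTerm S cl ξ xθ x t mask ≤ 0
    rw [closedTerm_mask hC hξ0 hξ1 (h1 _)]
    refine mul_nonpos_of_nonneg_of_nonpos
      (div_nonneg (S.deriv_βm_nonneg t ht) (S.βm_pos t ht).le) ?_
    calc _ ≤ ∑ k, (gammaMix cl ξ k (xθ t mask) - gammaPert cl ξ k x) := by
          refine Finset.sum_le_sum fun k _ => ?_
          have hg := gammaPert_pos (cl := cl) hC hξ0 hξ1 k x
          have hG := gammaMix_pos (cl := cl) hC hξ0 hξ1 (h0 mask) (h1 mask) k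
          calc _ ≤ gammaPert cl ξ k x * (gammaMix cl ξ k (xθ t mask) / gammaPert cl ξ k x - 1) :=
                mul_le_mul_of_nonneg_left (Real.log_le_sub_one_of_pos (div_pos hG hg)) hg.le
            _ = _ := by field_simp
      _ = 0 := by rw [Finset.sum_sub_distrib, sum_gammaMix hC (h1 _), sum_gammaPert hC, sub_self]

/-- The mean of the closed form over the forward marginal at a fixed time. -/
theorem sum_marginal_mul_closedTerm (hC : 2 ≤ Fintype.card C) (hξ0 : 0 < ξ) (hξ1 : ξ < 1)
    (ht : t ∈ Ioo (0 : ℝ) 1) (h1 : ∀ z, ∑ v, xθ t z v = 1) :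
    ∑ z, marginal S cl ξ t x z * closedTerm S cl ξ xθ x t z =
      -deriv S.α t * ∑ k, gammaPert cl ξ k x * Real.log
        (xθ t (cluster k) x * gammaPert cl ξ k x / gammaMix cl ξ k (xθ t (cluster k)))
      + deriv S.βm t * ∑ k, gammaPert cl ξ k x *
        Real.log (gammaMix cl ξ k (xθ t mask) / gammaPert cl ξ k x) := by
  have hβ := (S.βm_pos t ht).ne'
  rw [sum_state]
  simp only [closedTerm_mask hC hξ0 hξ1 (h1 _), closedTerm_cluster hC hξ0 hξ1 (h1 _)]
  have hw : ∑ v, marginal S cl ξ t x (word v) * closedTerm S cl ξ xθ x t (word v) = 0 :=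
    Finset.sum_eq_zero fun v _ => by simp [closedTerm]
  rw [hw, zero_add]
  congr 1
  · rw [Finset.mul_sum]
    refine Finset.sum_congr rfl fun k _ => ?_
    simp only [marginal]
    rw [← S.wordRate_mul ht]
    ring
  · simp only [marginal]
    rw [← mul_assoc, mul_div_cancel₀ _ hβ]

theorem rateElboTerm_word :
    rateElboTerm S cl ξ xθ x t (word x) = -(deriv S.α t / S.α t) := by
  unfold rateElboTerm
  rw [backRate_word, Finset.sum_eq_zero]
  · simp [rate]
  · rintro (v | k | ⟨⟩) h
    · have : v ≠ x := fun e => Finset.ne_of_mem_erase h (by rw [e])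
      simp [rate, this]
    · simp [rate]
    · simp [rate]

theorem rateElboTerm_cluster (hC : 2 ≤ Fintype.card C) (hξ0 : 0 < ξ) (hξ1 : ξ < 1)
    (ht : t ∈ Ioo (0 : ℝ) 1) {k : C} (h0 : ∀ v, 0 ≤ xθ t (cluster k) v)
    (h1 : ∑ v, xθ t (cluster k) v = 1) :
    gammaPert cl ξ k x * rateElboTerm S cl ξ xθ x t (cluster k) =
      S.wordRate t * gammaPert cl ξ k x * Real.log
        (xθ t (cluster k) x * gammaPert cl ξ k x / gammaMix cl ξ k (xθ t (cluster k)))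
      - gammaPert cl ξ k x * (deriv S.βc t / S.βc t) := by
  have hα := (S.α_pos t ht).ne'
  have hβ := (S.βc_pos t ht).ne'
  have hg := (gammaPert_pos (cl := cl) hC hξ0 hξ1 k x).ne'
  unfold rateElboTerm
  rw [backRate_cluster_cluster hC hξ0 hξ1 ht h0 h1, Finset.sum_eq_single (word x)]
  · rw [backRate_cluster_word ht]
    simp only [rate, marginal, if_true]
    -- If `α' = 0`, the argument of the logarithm is a quotient by `0`, but its coefficient vanishes
    -- too.
    by_cases hd : deriv S.α t = 0
    · simp [hd, Schedule.wordRate]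
    · have : S.wordRate t * (xθ t (cluster k) x * gammaPert cl ξ k x /
          gammaMix cl ξ k (xθ t (cluster k))) * (S.βc t * gammaPert cl ξ k x) /
          (-(deriv S.α t / S.α t) * gammaPert cl ξ k x * S.α t) =
          xθ t (cluster k) x * gammaPert cl ξ k x / gammaMix cl ξ k (xθ t (cluster k)) := by
        unfold Schedule.wordRate
        field_simp
      rw [this]
      unfold Schedule.wordRate
      field_simp
      ring
  · rintro (v | l | ⟨⟩) h hx
    · have : v ≠ x := fun e => hx (by rw [e])
      simp [marginal, this]
    · have : l ≠ k := fun e => Finset.ne_of_mem_erase h (by rw [e])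
      simp [rate, this]
    · simp [rate]
  · simp

theorem rateElboTerm_mask (hC : 2 ≤ Fintype.card C) (hξ0 : 0 < ξ) (hξ1 : ξ < 1)
    (ht : t ∈ Ioo (0 : ℝ) 1) (h1 : ∑ v, xθ t mask v = 1) :
    rateElboTerm S cl ξ xθ x t mask = deriv S.βm t / S.βm t * ∑ k, gammaPert cl ξ k x *
      Real.log (gammaMix cl ξ k (xθ t mask) / gammaPert cl ξ k x) - deriv S.βm t / S.βm t := by
  have hc := (S.βc_pos t ht).ne'
  have hβ := (S.βm_pos t ht).ne'
  have hs : deriv S.α t + deriv S.βc t = -deriv S.βm t := by linarith [S.sum_deriv ht]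
  unfold rateElboTerm
  rw [Finset.sum_erase _ (by simp [rate]), sum_state, backRate_mask_mask hC ht h1]
  simp only [backRate_mask_cluster ht h1, rate, marginal, hs]
  simp only [zero_mul, Finset.sum_const_zero, zero_add, add_zero, sub_eq_add_neg, neg_zero]
  rw [Finset.mul_sum]
  congr 1
  refine Finset.sum_congr rfl fun k _ => ?_
  have hg := (gammaPert_pos (cl := cl) hC hξ0 hξ1 k x).ne'
  by_cases hd : deriv S.βm t = 0
  · simp [hd]
  · have : deriv S.βm t / S.βm t * gammaMix cl ξ k (xθ t mask) * S.βm t /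
        (-(-deriv S.βm t / S.βc t) * (S.βc t * gammaPert cl ξ k x)) =
        gammaMix cl ξ k (xθ t mask) / gammaPert cl ξ k x := by
      field_simp
    rw [this]
    field_simp

/-- The closed form and the form in terms of rates have the same mean at every time. -/
theorem sum_marginal_mul_rateElboTerm (hC : 2 ≤ Fintype.card C) (hξ0 : 0 < ξ) (hξ1 : ξ < 1)
    (ht : t ∈ Ioo (0 : ℝ) 1) (h0 : ∀ z v, 0 ≤ xθ t z v) (h1 : ∀ z, ∑ v, xθ t z v = 1) :
    ∑ z, marginal S cl ξ t x z * rateElboTerm S cl ξ xθ x t z =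
      ∑ z, marginal S cl ξ t x z * closedTerm S cl ξ xθ x t z := by
  have hα := (S.α_pos t ht).ne'
  have hc := (S.βc_pos t ht).ne'
  have hβ := (S.βm_pos t ht).ne'
  rw [sum_marginal_mul_closedTerm hC hξ0 hξ1 ht h1, sum_state,
    rateElboTerm_mask hC hξ0 hξ1 ht (h1 _), Finset.sum_eq_single x
      (fun v _ hv => by simp [marginal, hv]) (by simp), rateElboTerm_word]
  have hk : ∀ k, marginal S cl ξ t x (cluster k) * rateElboTerm S cl ξ xθ x t (cluster k) =
      -deriv S.α t * (gammaPert cl ξ k x * Real.log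
        (xθ t (cluster k) x * gammaPert cl ξ k x / gammaMix cl ξ k (xθ t (cluster k))))
      - gammaPert cl ξ k x * deriv S.βc t := by
    intro k
    simp only [marginal]
    rw [mul_assoc, rateElboTerm_cluster hC hξ0 hξ1 ht (h0 _) (h1 _), ← S.wordRate_mul ht]
    field_simp
  simp only [hk, Finset.sum_sub_distrib, ← Finset.mul_sum, ← Finset.sum_mul, sum_gammaPert hC]
  simp only [marginal, if_true]
  have := S.sum_deriv ht
  field_simp
  -- The diagonal terms contribute `-(α' + βc' + βm') = 0` to the mean. They do not vanish state by
  -- state, which is why only the means agree.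
  linear_combination -this

omit [DecidableEq V] in
theorem closedTerm_eq_closedTermEta (hC : 2 ≤ Fintype.card C) (hξ0 : 0 < ξ) (hξ1 : ξ < 1)
    (z : State V C) : closedTerm S cl ξ xθ x t z =
      closedTermEta S cl ξ (((Fintype.card C : ℝ) - 1) * ξ / (1 - ξ)) xθ x t z := by
  have hN := card_sub_one_pos hC
  have hξ : 0 < 1 - ξ := by linarith
  have e1 : ∀ p : ℝ, p + (1 - ξ) / (ξ * ((Fintype.card C : ℝ) - 1)) * (1 - p) =
      (1 - 1 / (((Fintype.card C : ℝ) - 1) * ξ / (1 - ξ))) * p +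
        1 / (((Fintype.card C : ℝ) - 1) * ξ / (1 - ξ)) := by
    intro p
    field_simp
    ring
  have e2 : ∀ p : ℝ, ξ * ((Fintype.card C : ℝ) - 1) / (1 - ξ) * p + (1 - p) =
      (((Fintype.card C : ℝ) - 1) * ξ / (1 - ξ) - 1) * p + 1 := by
    intro p
    ring
  obtain v | k | ⟨⟩ := z
  · rfl
  · simp only [closedTerm, closedTermEta, e1, e2]
  · simp only [closedTerm, closedTermEta, e1, e2]
    have : (1 - ξ) / ((Fintype.card C : ℝ) - 1) =
        ξ * (1 / (((Fintype.card C : ℝ) - 1) * ξ / (1 - ξ))) := by field_simp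
    rw [this]
    ring

/-- Division by `1 - ξ = 0` gives `0`, and the affected terms carry a zero factor anyway: the
marginal of a wrong cluster, or the coefficient `(1 - ξ) / (N - 1)` in the mask state. -/
theorem sum_marginal_mul_closedTerm_one :
    ∑ z, marginal S cl 1 t x z * closedTerm S cl 1 xθ x t z =
      ∑ z, stdMarginal S cl t x z * stdTerm S cl xθ x t z := by
  refine Finset.sum_congr rfl fun z _ => ?_
  obtain v | k | ⟨⟩ := z
  · simp [closedTerm, stdTerm]
  · by_cases h : k = cl x
    · subst h
      simp [marginal, closedTerm, stdMarginal, stdTerm, gammaPert]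
    · simp [marginal, stdMarginal, gammaPert, h]
  · simp [marginal, closedTerm, stdMarginal, stdTerm]

omit [DecidableEq V] [DecidableEq C] in
theorem extMean_congr {q q' f f' : ℝ → State V C → ℝ}
    (h : ∀ t ∈ Ioo (0 : ℝ) 1, ∑ z, q t z * f t z = ∑ z, q' t z * f' t z) :
    extMean q f = extMean q' f' := by
  unfold extMean
  rw [setLIntegral_congr_fun measurableSet_Ioo (fun t ht => by rw [h t ht]),
    setLIntegral_congr_fun (f := fun t => ENNReal.ofReal (-∑ z, q t z * f t z)) measurableSet_Ioo
      (fun t ht => by simp only [h t ht]; rfl)]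

omit [DecidableEq V] in
/-- The asymptotics of the logarithmic terms as the perturbation vanishes. -/
theorem tendsto_gammaPert_mul_log (hC : 2 ≤ Fintype.card C) {c : ℝ} (hc : 0 < c) {y : V → ℝ}
    (h0 : ∀ v, 0 ≤ y v) (h1 : ∑ v, y v = 1) (hx : 0 < y x) (k : C) :
    Tendsto (fun ξ' => gammaPert cl ξ' k x *
        Real.log (c * gammaPert cl ξ' k x / gammaMix cl ξ' k y)) (𝓝[<] 1)
      (𝓝 (if k = cl x then Real.log (c / clusterMass cl y (cl x)) else 0)) := by
  have hN := card_sub_one_pos hC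
  have hG : Tendsto (fun ξ' => gammaMix cl ξ' k y) (𝓝[<] 1) (𝓝 (clusterMass cl y k)) := by
    simp only [gammaMix_eq h1]
    have : Continuous fun ξ' : ℝ => ξ' * clusterMass cl y k
      + (1 - ξ') / ((Fintype.card C : ℝ) - 1) * (1 - clusterMass cl y k) := by fun_prop
    convert (this.tendsto 1).mono_left nhdsWithin_le_nhds using 2
    simp
  have hnn : 0 ≤ clusterMass cl y k := Finset.sum_nonneg fun v _ => h0 v
  by_cases h : k = cl x
  · subst h
    simp only [gammaPert, if_true]
    have hp : 0 < clusterMass cl y (cl x) :=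
      hx.trans_le (Finset.single_le_sum (f := y) (fun v _ => h0 v) (by simp))
    have hid : Tendsto (fun ξ' : ℝ => ξ') (𝓝[<] 1) (𝓝 1) := tendsto_id.mono_left nhdsWithin_le_nhds
    have := hid.mul (((hid.const_mul c).div hG hp.ne').log (by simpa using (div_pos hc hp).ne'))
    simpa using this
  · simp only [gammaPert, h, if_false]
    set N1 : ℝ := (Fintype.card C : ℝ) - 1
    have hg : Tendsto (fun ξ' : ℝ => (1 - ξ') / N1) (𝓝[<] 1) (𝓝 0) := by
      have : Continuous fun ξ' : ℝ => (1 - ξ') / N1 := by fun_prop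
      simpa using (this.tendsto 1).mono_left nhdsWithin_le_nhds
    -- For a wrong cluster the weight tends to `0`. If the cluster has no predicted mass, `gammaMix`
    -- equals that weight and the logarithm is constant; otherwise the limit rests on `g log g → 0`.
    obtain hp | hp := hnn.eq_or_lt
    · have he : ∀ᶠ ξ' in 𝓝[<] (1 : ℝ), (1 - ξ') / N1 * Real.log c =
          (1 - ξ') / N1 * Real.log (c * ((1 - ξ') / N1) / gammaMix cl ξ' k y) := by
        filter_upwards [self_mem_nhdsWithin] with ξ' hξ'
        have : (1 - ξ') / N1 ≠ 0 := (div_pos (sub_pos.2 hξ') hN).ne'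
        rw [gammaMix_eq h1, ← hp, mul_zero, zero_add, sub_zero, mul_one, mul_div_cancel_right₀ _ this]
      refine Tendsto.congr' he ?_
      simpa using hg.mul_const (Real.log c)
    · have he : ∀ᶠ ξ' in 𝓝[<] (1 : ℝ), (1 - ξ') / N1 * Real.log (c / gammaMix cl ξ' k y) +
          (1 - ξ') / N1 * Real.log ((1 - ξ') / N1) =
          (1 - ξ') / N1 * Real.log (c * ((1 - ξ') / N1) / gammaMix cl ξ' k y) := by
        filter_upwards [self_mem_nhdsWithin, hG.eventually (lt_mem_nhds hp)] with ξ' hξ' hG'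
        have : (1 - ξ') / N1 ≠ 0 := (div_pos (sub_pos.2 hξ') hN).ne'
        rw [mul_div_right_comm, Real.log_mul (div_pos hc hG').ne' this]
        ring
      refine Tendsto.congr' he ?_
      have h1 := hg.mul ((tendsto_const_nhds (x := c)).div hG hp.ne' |>.log (div_pos hc hp).ne')
      have h2 := (Real.continuous_mul_log.tendsto 0).comp hg
      simpa using h1.add h2

/-- As the perturbation vanishes, the mean of the closed form tends to that of the closed form
without perturbations. -/
theorem tendsto_sum_marginal_mul_closedTerm (hC : 2 ≤ Fintype.card C) (ht : t ∈ Ioo (0 : ℝ) 1)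
    (h0 : ∀ z v, 0 ≤ xθ t z v) (h1 : ∀ z, ∑ v, xθ t z v = 1) (hxm : 0 < xθ t mask x)
    (hxc : ∀ k, 0 < xθ t (cluster k) x) :
    Tendsto (fun ξ' : ℝ => ∑ z, marginal S cl ξ' t x z * closedTerm S cl ξ' xθ x t z) (𝓝[<] 1)
      (𝓝 (∑ z, stdMarginal S cl t x z * stdTerm S cl xθ x t z)) := by
  -- Inverting the quotient in the mask logarithm lets one limit lemma serve both sums, with `c = 1`
  -- for the mask.
  have he : ∀ᶠ ξ' in 𝓝[<] (1 : ℝ),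
      -deriv S.α t * ∑ k, gammaPert cl ξ' k x * Real.log
        (xθ t (cluster k) x * gammaPert cl ξ' k x / gammaMix cl ξ' k (xθ t (cluster k)))
      - deriv S.βm t * ∑ k, gammaPert cl ξ' k x *
        Real.log (1 * gammaPert cl ξ' k x / gammaMix cl ξ' k (xθ t mask)) =
      ∑ z, marginal S cl ξ' t x z * closedTerm S cl ξ' xθ x t z := by
    filter_upwards [Ioo_mem_nhdsLT (zero_lt_one (α := ℝ))] with ξ' hξ'
    rw [sum_marginal_mul_closedTerm hC hξ'.1 hξ'.2 ht h1, sub_eq_add_neg, ← mul_neg,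
      ← Finset.sum_neg_distrib]
    simp only [one_mul]
    congr 2
    refine Finset.sum_congr rfl fun k _ => ?_
    rw [← inv_div, Real.log_inv, mul_neg, neg_neg]
  refine Tendsto.congr' he ?_
  have hβ := (S.βm_pos t ht).ne'
  have hl : ∑ z, stdMarginal S cl t x z * stdTerm S cl xθ x t z =
      -deriv S.α t * ∑ k, (if k = cl x then
        Real.log (xθ t (cluster k) x / clusterMass cl (xθ t (cluster k)) (cl x)) else 0)
      - deriv S.βm t * ∑ k, (if k = cl x then
        Real.log (1 / clusterMass cl (xθ t mask) (cl x)) else 0) := by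
    rw [sum_state, ← S.wordRate_mul ht]
    simp only [stdMarginal, stdTerm, Schedule.wordRate, mul_zero, Finset.sum_const_zero, ite_mul,
      zero_mul, Finset.sum_ite_eq', Finset.mem_univ, if_true, one_div, Real.log_inv]
    field_simp
    ring
  rw [hl]
  exact ((tendsto_finsetSum _ fun k _ => tendsto_gammaPert_mul_log hC (hxc k) (h0 _) (h1 _)
    (hxc k) k).const_mul _).sub ((tendsto_finsetSum _ fun k _ =>
      tendsto_gammaPert_mul_log hC one_pos (h0 _) (h1 _) hxm k).const_mul _)

end Algebra

/-! ### Boundary behaviour of the schedule and a comparison principle. -/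

theorem tendsto_nhdsLT_one_of_continuousOn {f : ℝ → ℝ} (hf : ContinuousOn f (Icc 0 1)) :
    Tendsto f (𝓝[<] 1) (𝓝 (f 1)) := by
  rw [← nhdsWithin_Ioo_eq_nhdsLT (zero_lt_one (α := ℝ))]
  exact (hf 1 (by simp)).mono_left (nhdsWithin_mono _ Ioo_subset_Icc_self)

theorem tendsto_nhdsGT_zero_of_continuousOn {f : ℝ → ℝ} (hf : ContinuousOn f (Icc 0 1)) :
    Tendsto f (𝓝[>] 0) (𝓝 (f 0)) := by
  rw [← nhdsWithin_Ioo_eq_nhdsGT (zero_lt_one (α := ℝ))]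
  exact (hf 0 (by simp)).mono_left (nhdsWithin_mono _ Ioo_subset_Icc_self)

theorem continuousOn_Icc_zero_one {f : ℝ → ℝ} (h : ContinuousOn f (Ioo 0 1))
    (h0 : Tendsto f (𝓝[>] 0) (𝓝 (f 0))) (h1 : Tendsto f (𝓝[<] 1) (𝓝 (f 1))) :
    ContinuousOn f (Icc 0 1) := by
  intro t ht
  obtain rfl | h0' := ht.1.eq_or_lt
  · rw [← continuousWithinAt_sdiff_self]
    exact Tendsto.mono_left h0 (nhdsWithin_mono _ fun u hu => hu.1.1.lt_of_ne (Ne.symm hu.2))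
  obtain rfl | h1' := ht.2.eq_or_lt
  · rw [← continuousWithinAt_sdiff_self]
    exact Tendsto.mono_left h1 (nhdsWithin_mono _ fun u hu => hu.1.2.lt_of_ne hu.2)
  · exact (h.continuousAt (Ioo_mem_nhds h0' h1')).continuousWithinAt

namespace Schedule

variable (S : Schedule) {t : ℝ}

theorem nonneg_Icc {f : ℝ → ℝ} (hf : ContinuousOn f (Icc 0 1))
    (h : ∀ t ∈ Ioo (0 : ℝ) 1, 0 < f t) (ht : t ∈ Icc (0 : ℝ) 1) : 0 ≤ f t := by
  obtain rfl | h0 := ht.1.eq_or_lt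
  · refine ge_of_tendsto (tendsto_nhdsGT_zero_of_continuousOn hf) ?_
    filter_upwards [Ioo_mem_nhdsGT (zero_lt_one (α := ℝ))] with u hu using (h u hu).le
  obtain rfl | h1 := ht.2.eq_or_lt
  · refine ge_of_tendsto (tendsto_nhdsLT_one_of_continuousOn hf) ?_
    filter_upwards [Ioo_mem_nhdsLT (zero_lt_one (α := ℝ))] with u hu using (h u hu).le
  · exact (h t ⟨h0, h1⟩).le

theorem α_nonneg (ht : t ∈ Icc (0 : ℝ) 1) : 0 ≤ S.α t := nonneg_Icc S.continuousOn_α S.α_pos ht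

theorem βc_nonneg (ht : t ∈ Icc (0 : ℝ) 1) : 0 ≤ S.βc t := nonneg_Icc S.continuousOn_βc S.βc_pos ht

theorem βm_nonneg (ht : t ∈ Icc (0 : ℝ) 1) : 0 ≤ S.βm t := nonneg_Icc S.continuousOn_βm S.βm_pos ht

theorem α_one : S.α 1 = 0 := by
  have h : (1 : ℝ) ∈ Icc (0 : ℝ) 1 := by simp
  linarith [S.α_nonneg h, S.βc_nonneg h, S.sum_eq_one 1 h, S.βm_one]

theorem βc_one : S.βc 1 = 0 := by
  have h : (1 : ℝ) ∈ Icc (0 : ℝ) 1 := by simp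
  linarith [S.α_nonneg h, S.βc_nonneg h, S.sum_eq_one 1 h, S.βm_one]

theorem βc_zero : S.βc 0 = 0 := by
  have h : (0 : ℝ) ∈ Icc (0 : ℝ) 1 := by simp
  linarith [S.βm_nonneg h, S.βc_nonneg h, S.sum_eq_one 0 h, S.α_zero]

theorem continuousOn_deriv_α : ContinuousOn (deriv S.α) (Ioo 0 1) :=
  S.contDiffOn_α.continuousOn_deriv_of_isOpen isOpen_Ioo le_rfl

theorem continuousOn_deriv_βc : ContinuousOn (deriv S.βc) (Ioo 0 1) :=
  S.contDiffOn_βc.continuousOn_deriv_of_isOpen isOpen_Ioo le_rfl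

theorem continuousOn_deriv_βm : ContinuousOn (deriv S.βm) (Ioo 0 1) :=
  S.contDiffOn_βm.continuousOn_deriv_of_isOpen isOpen_Ioo le_rfl

theorem hasIntDeriv_α : HasIntDeriv S.α (deriv S.α) :=
  .of_hasDerivAt (fun _ ht => S.hasDerivAt_α ht) S.continuousOn_deriv_α

theorem hasIntDeriv_βc : HasIntDeriv S.βc (deriv S.βc) :=
  .of_hasDerivAt (fun _ ht => S.hasDerivAt_βc ht) S.continuousOn_deriv_βc

theorem hasIntDeriv_βm : HasIntDeriv S.βm (deriv S.βm) :=
  .of_hasDerivAt (fun _ ht => S.hasDerivAt_βm ht) S.continuousOn_deriv_βm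

theorem continuousOn_wordRate : ContinuousOn S.wordRate (Ioo 0 1) :=
  S.continuousOn_deriv_α.neg.div (S.continuousOn_βc.mono Ioo_subset_Icc_self)
    fun t ht => (S.βc_pos t ht).ne'

/-- The solution of `D' = -wordRate * D` on `(0, 1)` with `D (1 / 2) = 1`. -/
noncomputable def decay (t : ℝ) : ℝ := Real.exp (-∫ u in (1 / 2 : ℝ)..t, S.wordRate u)

theorem decay_pos (t : ℝ) : 0 < S.decay t := Real.exp_pos _

theorem hasDerivAt_decay (ht : t ∈ Ioo (0 : ℝ) 1) :
    HasDerivAt S.decay (-(S.wordRate t * S.decay t)) t := by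
  have hsub : uIcc (1 / 2 : ℝ) t ⊆ Ioo 0 1 :=
    ordConnected_Ioo.uIcc_subset (by norm_num) ht
  have h := intervalIntegral.integral_hasDerivAt_right
    (S.continuousOn_wordRate.mono hsub).intervalIntegrable
    (S.continuousOn_wordRate.stronglyMeasurableAtFilter isOpen_Ioo t ht)
    (S.continuousOn_wordRate.continuousAt (isOpen_Ioo.mem_nhds ht))
  have h' : HasDerivAt (fun u => -∫ v in (1 / 2 : ℝ)..u, S.wordRate v) (-S.wordRate t) t := h.neg
  have he := h'.exp
  rw [mul_neg, mul_comm] at he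
  exact he

theorem continuousOn_decay : ContinuousOn S.decay (Ioo 0 1) :=
  fun _ ht => (S.hasDerivAt_decay ht).continuousAt.continuousWithinAt

theorem hasIntDeriv_decay : HasIntDeriv S.decay (fun t => -(S.wordRate t * S.decay t)) :=
  .of_hasDerivAt (fun _ ht => S.hasDerivAt_decay ht)
    (S.continuousOn_wordRate.mul S.continuousOn_decay).neg

theorem decay_le {s t : ℝ} (hs : 0 < s) (hst : s ≤ t) (ht : t < 1) : S.decay t ≤ S.decay s :=
  S.hasIntDeriv_decay.le_of_nonpos (fun _ hu => neg_nonpos.2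
    (mul_nonneg (S.wordRate_nonneg hu) (S.decay_pos _).le)) hs hst ht

/-- A comparison principle for the linear equation satisfied by the cluster probabilities. -/
theorem nonneg_of_hasIntDeriv {f g : ℝ → ℝ}
    (hf : HasIntDeriv f (fun t => S.wordRate t * f t - g t)) (hg : ∀ t ∈ Ioo (0 : ℝ) 1, 0 ≤ g t)
    (h1 : Tendsto f (𝓝[<] 1) (𝓝 0)) (ht : t ∈ Ioo (0 : ℝ) 1) : 0 ≤ f t := by
  -- `decay` is an integrating factor: the derivative of `f * decay` is `-g * decay ≤ 0`.
  have hle : ∀ u, t ≤ u → u < 1 → f u * S.decay u ≤ f t * S.decay t := fun u htu hu =>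
    (hf.mul S.hasIntDeriv_decay).le_of_nonpos (fun v hv => by
      have := mul_nonneg (hg v hv) (S.decay_pos v).le
      linarith) ht.1 htu hu
  -- `wordRate` need not be integrable up to `1`, but `decay` is nonincreasing, hence bounded by
  -- `S.decay t` on `[t, 1)`.
  have hlim : Tendsto (fun u => f u * S.decay u) (𝓝[<] 1) (𝓝 0) := by
    refine squeeze_zero_norm' (a := fun u => |f u| * S.decay t) ?_ ?_
    · filter_upwards [Ioo_mem_nhdsLT ht.2] with u hu
      rw [Real.norm_eq_abs, abs_mul, abs_of_pos (S.decay_pos u)]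
      exact mul_le_mul_of_nonneg_left (S.decay_le ht.1 hu.1.le hu.2) (abs_nonneg _)
    · simpa using h1.abs.mul_const (S.decay t)
  have : 0 ≤ f t * S.decay t := by
    refine le_of_tendsto hlim ?_
    filter_upwards [Ioo_mem_nhdsLT ht.2] with u hu using hle u hu.1.le hu.2
  exact nonneg_of_mul_nonneg_left this (S.decay_pos t)

end Schedule

/-! ### The master equation, and two-sided bounds for any reverse law. -/

section ReverseLaw

variable {V C : Type*} [Fintype V] [DecidableEq V] [Fintype C] [DecidableEq C]
variable {S : Schedule} {cl : V → C} {ξ t : ℝ} {xθ : ℝ → State V C → V → ℝ} {x : V}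

theorem sum_mul_backRate_mask (hC : 2 ≤ Fintype.card C) (ht : t ∈ Ioo (0 : ℝ) 1)
    (h1 : ∑ v, xθ t mask v = 1) (p : State V C → ℝ) :
    ∑ z', p z' * backRate S cl ξ xθ t z' mask = -(deriv S.βm t / S.βm t * p mask) := by
  rw [sum_state]
  simp only [backRate_word, backRate_cluster_mask, backRate_mask_mask hC ht h1]
  simp
  ring

theorem sum_mul_backRate_cluster (hC : 2 ≤ Fintype.card C) (hξ0 : 0 < ξ) (hξ1 : ξ < 1)
    (ht : t ∈ Ioo (0 : ℝ) 1) (h0 : ∀ z v, 0 ≤ xθ t z v) (h1 : ∀ z, ∑ v, xθ t z v = 1)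
    (p : State V C → ℝ) (k : C) :
    ∑ z', p z' * backRate S cl ξ xθ t z' (cluster k) =
      p mask * (deriv S.βm t / S.βm t) * gammaMix cl ξ k (xθ t mask)
        - S.wordRate t * p (cluster k) := by
  rw [sum_state]
  simp only [backRate_word, backRate_cluster_cluster hC hξ0 hξ1 ht (h0 _) (h1 _),
    backRate_mask_cluster ht (h1 _)]
  simp
  ring

/-- The rate at which the reverse process with cluster probabilities `p` produces the word `v`. -/
noncomputable def wordFlow (S : Schedule) (cl : V → C) (ξ : ℝ) (xθ : ℝ → State V C → V → ℝ)
    (p : C → ℝ) (v : V) (t : ℝ) : ℝ :=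
  ∑ k, p k * (S.wordRate t *
    (xθ t (cluster k) v * gammaPert cl ξ k v / gammaMix cl ξ k (xθ t (cluster k))))

theorem sum_mul_backRate_word (ht : t ∈ Ioo (0 : ℝ) 1) (p : State V C → ℝ) (v : V) :
    ∑ z', p z' * backRate S cl ξ xθ t z' (word v) =
      wordFlow S cl ξ xθ (fun k => p (cluster k)) v t := by
  rw [sum_state]
  simp only [backRate_word, backRate_mask_word, backRate_cluster_word ht]
  simp [wordFlow]

namespace IsReverseLaw

variable {p : ℝ → State V C → ℝ}

theorem hasIntDeriv (hp : IsReverseLaw S cl ξ xθ p) (z : State V C) :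
    HasIntDeriv (fun t => p t z) (fun u => -∑ z', p u z' * backRate S cl ξ xθ u z' z) := by
  intro s t hs hst ht
  refine ⟨(hp.integrable s t hs hst ht z).neg, ?_⟩
  rw [intervalIntegral.integral_neg, ← hp.master s t hs hst ht z]
  ring

/-- The quotient `p_t(mask) / βm` has zero derivative and tends to `1` at time `1`. -/
theorem mask_eq (hC : 2 ≤ Fintype.card C) (hsum : ∀ t ∈ Ioo (0 : ℝ) 1, ∀ z, ∑ v, xθ t z v = 1)
    (hp : IsReverseLaw S cl ξ xθ p) (ht : t ∈ Ioo (0 : ℝ) 1) : p t mask = S.βm t := by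
  have hinv : HasIntDeriv (fun u => (S.βm u)⁻¹) (fun u => -deriv S.βm u / S.βm u ^ 2) := by
    refine .of_hasDerivAt (fun u hu => (S.hasDerivAt_βm hu).inv (S.βm_pos u hu).ne') ?_
    exact S.continuousOn_deriv_βm.neg.div ((S.continuousOn_βm.mono Ioo_subset_Icc_self).pow 2)
      fun u hu => (pow_pos (S.βm_pos u hu) 2).ne'
  have hq : HasIntDeriv (fun u => p u mask * (S.βm u)⁻¹) (fun _ => 0) := by
    refine ((hp.hasIntDeriv mask).mul hinv).congr (fun _ _ => rfl) fun u hu => ?_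
    have := (S.βm_pos u hu).ne'
    rw [sum_mul_backRate_mask hC hu (hsum u hu _)]
    field_simp
    ring
  have hlim : Tendsto (fun u => p u mask * (S.βm u)⁻¹) (𝓝[<] 1) (𝓝 1) := by
    have h1 := tendsto_nhdsLT_one_of_continuousOn (hp.continuousOn mask)
    have h2 := (tendsto_nhdsLT_one_of_continuousOn S.continuousOn_βm).inv₀ (by simp [S.βm_one])
    simpa [hp.start, S.βm_one] using h1.mul h2
  have hc : Tendsto (fun u => p u mask * (S.βm u)⁻¹) (𝓝[<] 1) (𝓝 (p t mask * (S.βm t)⁻¹)) := by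
    refine tendsto_const_nhds.congr' ?_
    filter_upwards [Ioo_mem_nhdsLT ht.2] with u hu
    have := (hq t u ht.1 hu.1.le hu.2).2
    simp only [intervalIntegral.integral_zero] at this
    linarith
  have := tendsto_nhds_unique hc hlim
  rwa [← div_eq_mul_inv, div_eq_one_iff_eq (S.βm_pos t ht).ne'] at this

theorem hasIntDeriv_cluster (hC : 2 ≤ Fintype.card C) (hξ0 : 0 < ξ) (hξ1 : ξ < 1)
    (hnonneg : ∀ t ∈ Ioo (0 : ℝ) 1, ∀ z v, 0 ≤ xθ t z v)
    (hsum : ∀ t ∈ Ioo (0 : ℝ) 1, ∀ z, ∑ v, xθ t z v = 1)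
    (hp : IsReverseLaw S cl ξ xθ p) (k : C) :
    HasIntDeriv (fun t => p t (cluster k)) (fun u =>
      S.wordRate u * p u (cluster k) - deriv S.βm u * gammaMix cl ξ k (xθ u mask)) := by
  refine (hp.hasIntDeriv (cluster k)).congr (fun _ _ => rfl) fun u hu => ?_
  have := (S.βm_pos u hu).ne'
  rw [sum_mul_backRate_cluster hC hξ0 hξ1 hu (hnonneg u hu) (hsum u hu), hp.mask_eq hC hsum hu]
  field_simp
  ring

theorem tendsto_cluster (hp : IsReverseLaw S cl ξ xθ p) (k : C) :
    Tendsto (fun t => p t (cluster k)) (𝓝[<] 1) (𝓝 0) := by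
  simpa [hp.start] using tendsto_nhdsLT_one_of_continuousOn (hp.continuousOn (cluster k))

/-- The cluster probabilities of a reverse law are comparable to those of the forward process. -/
theorem cluster_mem_Icc (hC : 2 ≤ Fintype.card C) (hξ0 : 0 < ξ) (hξ1 : ξ < 1)
    (hnonneg : ∀ t ∈ Ioo (0 : ℝ) 1, ∀ z v, 0 ≤ xθ t z v)
    (hsum : ∀ t ∈ Ioo (0 : ℝ) 1, ∀ z, ∑ v, xθ t z v = 1)
    (hp : IsReverseLaw S cl ξ xθ p) (k : C) (ht : t ∈ Ioo (0 : ℝ) 1) :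
    p t (cluster k) ∈ Icc (gammaMin C ξ * S.βc t) (S.βc t) := by
  have hd := hp.hasIntDeriv_cluster hC hξ0 hξ1 hnonneg hsum k
  have hl := hp.tendsto_cluster k
  have hb : Tendsto S.βc (𝓝[<] 1) (𝓝 0) := by
    simpa [S.βc_one] using tendsto_nhdsLT_one_of_continuousOn S.continuousOn_βc
  constructor
  -- Since `wordRate * βc = -α'`, `βc` solves the cluster equation with source `βm'`. So the
  -- difference has source `βm' (G_k - gammaMin)`, which is nonnegative; the upper bound uses `βm'
  -- (1 - G_k)` in the same way.
  · rw [← sub_nonneg]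
    refine S.nonneg_of_hasIntDeriv (f := fun t => p t (cluster k) - gammaMin C ξ * S.βc t)
      (g := fun u => deriv S.βm u * (gammaMix cl ξ k (xθ u mask) - gammaMin C ξ))
      ((hd.sub (S.hasIntDeriv_βc.const_mul _)).congr (fun _ _ => rfl) fun u hu => ?_)
      (fun u hu => mul_nonneg (S.deriv_βm_nonneg u hu)
        (sub_nonneg.2 (gammaMin_le_gammaMix (hnonneg u hu _) (hsum u hu _) k)))
      (by simpa using hl.sub (hb.const_mul _)) ht
    linear_combination -gammaMin C ξ * S.sum_deriv hu + gammaMin C ξ * S.wordRate_mul hu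
  · rw [← sub_nonneg]
    refine S.nonneg_of_hasIntDeriv (f := fun t => S.βc t - p t (cluster k))
      (g := fun u => deriv S.βm u * (1 - gammaMix cl ξ k (xθ u mask)))
      ((S.hasIntDeriv_βc.sub hd).congr (fun _ _ => rfl) fun u hu => ?_)
      (fun u hu => mul_nonneg (S.deriv_βm_nonneg u hu)
        (sub_nonneg.2 (gammaMix_le_one hC hξ0 hξ1 (hnonneg u hu _) (hsum u hu _) k)))
      (by simpa using hb.sub hl) ht
    linear_combination S.sum_deriv hu - S.wordRate_mul hu

end IsReverseLaw

end ReverseLaw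

/-! ### Integrals up to time `1`. -/

theorem hasIntDeriv_integral_right {g : ℝ → ℝ}
    (hg : ∀ t ∈ Ioo (0 : ℝ) 1, IntervalIntegrable g volume t 1) :
    HasIntDeriv (fun t => ∫ u in t..1, g u) (fun u => -g u) := by
  intro s t hs hst ht
  have h1 := hg s ⟨hs, hst.trans_lt ht⟩
  have h2 := hg t ⟨hs.trans_le hst, ht⟩
  have h3 : IntervalIntegrable g volume s t := h1.trans h2.symm
  refine ⟨h3.neg, ?_⟩
  dsimp only
  rw [intervalIntegral.integral_neg, ← intervalIntegral.integral_add_adjacent_intervals h3 h2]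
  ring

namespace Schedule

variable (S : Schedule) {t : ℝ}

/-- The derivative may be unbounded at the endpoints; its sign and the continuity of `βm` on `[0,
1]` make it integrable. -/
theorem intervalIntegrable_deriv_βm : IntervalIntegrable (deriv S.βm) volume 0 1 := by
  refine intervalIntegral.intervalIntegrable_deriv_of_nonneg (g := S.βm) ?_ ?_ ?_
  · simpa using S.continuousOn_βm
  · simpa using fun t h0 h1 => S.hasDerivAt_βm (t := t) ⟨h0, h1⟩
  · simpa using fun t h0 h1 => S.deriv_βm_nonneg t ⟨h0, h1⟩

theorem intervalIntegrable_deriv_α : IntervalIntegrable (deriv S.α) volume 0 1 := by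
  have : IntervalIntegrable (fun t => -deriv S.α t) volume 0 1 := by
    refine intervalIntegral.intervalIntegrable_deriv_of_nonneg (g := fun t => -S.α t) ?_ ?_ ?_
    · rw [uIcc_of_le zero_le_one]
      exact S.continuousOn_α.neg
    · rw [min_eq_left zero_le_one, max_eq_right zero_le_one]
      exact fun t ht => (S.hasDerivAt_α ht).neg
    · simpa using fun t h0 h1 => S.deriv_α_nonpos t ⟨h0, h1⟩
  exact this.neg.congr fun t _ => neg_neg _

theorem integral_deriv_βm (ht : t ∈ Ioo (0 : ℝ) 1) : ∫ u in t..1, deriv S.βm u = 1 - S.βm t := by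
  conv_rhs => rw [← S.βm_one]
  refine intervalIntegral.integral_eq_sub_of_hasDerivAt_of_le ht.2.le
    (S.continuousOn_βm.mono (Icc_subset_Icc_left ht.1.le))
    (fun u hu => S.hasDerivAt_βm ⟨ht.1.trans hu.1, hu.2⟩)
    (S.intervalIntegrable_deriv_βm.mono_set ?_)
  rw [uIcc_of_le ht.2.le, uIcc_of_le zero_le_one]
  exact Icc_subset_Icc_left ht.1.le

theorem integral_deriv_α (ht : t ∈ Icc (0 : ℝ) 1) : ∫ u in t..1, deriv S.α u = -S.α t := by
  rw [← zero_sub, ← S.α_one]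
  refine intervalIntegral.integral_eq_sub_of_hasDerivAt_of_le ht.2
    (S.continuousOn_α.mono (Icc_subset_Icc_left ht.1))
    (fun u hu => S.hasDerivAt_α ⟨ht.1.trans_lt hu.1, hu.2⟩)
    (S.intervalIntegrable_deriv_α.mono_set ?_)
  rw [uIcc_of_le ht.2, uIcc_of_le zero_le_one]
  exact Icc_subset_Icc_left ht.1

end Schedule

/-! ### Construction of a reverse law. -/

section Existence

variable {V C : Type*} [Fintype V] [DecidableEq V] [Fintype C] [DecidableEq C]
variable {S : Schedule} {cl : V → C} {ξ t : ℝ} {xθ : ℝ → State V C → V → ℝ}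

omit [DecidableEq V] in
theorem measurable_gammaMix (hmeas : ∀ z v, Measurable (fun t => xθ t z v)) (k : C)
    (z : State V C) : Measurable (fun t => gammaMix cl ξ k (xθ t z)) :=
  Finset.measurable_fun_sum _ fun v _ => (hmeas z v).mul_const _

/-- The rate of entering the cluster `k`, discounted by `Schedule.decay`. -/
noncomputable def clusterSource (S : Schedule) (cl : V → C) (ξ : ℝ)
    (xθ : ℝ → State V C → V → ℝ) (k : C) (u : ℝ) : ℝ :=
  deriv S.βm u * (gammaMix cl ξ k (xθ u mask) * S.decay u)

/-- The cluster probabilities of the reverse law, by variation of constants. -/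
noncomputable def revCluster (S : Schedule) (cl : V → C) (ξ : ℝ) (xθ : ℝ → State V C → V → ℝ)
    (k : C) : ℝ → ℝ :=
  -- The formula need not make sense at `0` and `1`, where `wordRate` may fail to be integrable. The
  -- indicator assigns the value `0`, which turns out to be the limit at both ends.
  (Ioo (0 : ℝ) 1).indicator fun t => (S.decay t)⁻¹ * ∫ u in t..1, clusterSource S cl ξ xθ k u

/-- The reverse law. -/
noncomputable def revLaw (S : Schedule) (cl : V → C) (ξ : ℝ) (xθ : ℝ → State V C → V → ℝ)
    (t : ℝ) : State V C → ℝ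
  | Sum.inl v => ∫ u in t..1, wordFlow S cl ξ xθ (fun k => revCluster S cl ξ xθ k u) v u
  | Sum.inr (Sum.inl k) => revCluster S cl ξ xθ k t
  | Sum.inr (Sum.inr ()) => S.βm t

variable (hC : 2 ≤ Fintype.card C) (hξ0 : 0 < ξ) (hξ1 : ξ < 1)
    (hmeas : ∀ z v, Measurable (fun t => xθ t z v))
    (hnonneg : ∀ t ∈ Ioo (0 : ℝ) 1, ∀ z v, 0 ≤ xθ t z v)
    (hsum : ∀ t ∈ Ioo (0 : ℝ) 1, ∀ z, ∑ v, xθ t z v = 1)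
include hC hξ0 hξ1 hnonneg hsum

omit [DecidableEq V] in
theorem clusterSource_mem_Icc (k : C) (ht : t ∈ Ioo (0 : ℝ) 1) {u : ℝ} (hu : u ∈ Ioo t 1) :
    clusterSource S cl ξ xθ k u ∈ Icc 0 (deriv S.βm u * S.decay t) := by
  have hu' : u ∈ Ioo (0 : ℝ) 1 := ⟨ht.1.trans hu.1, hu.2⟩
  have hb := S.deriv_βm_nonneg u hu'
  have hG := gammaMix_pos (cl := cl) hC hξ0 hξ1 (hnonneg u hu' mask) (hsum u hu' mask) k
  have hG1 := gammaMix_le_one (cl := cl) hC hξ0 hξ1 (hnonneg u hu' mask) (hsum u hu' mask) k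
  have hD := S.decay_pos u
  refine ⟨mul_nonneg hb (mul_nonneg hG.le hD.le), mul_le_mul_of_nonneg_left ?_ hb⟩
  calc _ ≤ 1 * S.decay u := mul_le_mul_of_nonneg_right hG1 hD.le
    _ ≤ S.decay t := by rw [one_mul]; exact S.decay_le ht.1 hu.1.le hu.2

include hmeas

omit [DecidableEq V] in
theorem intervalIntegrable_clusterSource (k : C) (ht : t ∈ Ioo (0 : ℝ) 1) :
    IntervalIntegrable (clusterSource S cl ξ xθ k) volume t 1 := by
  have hb : IntegrableOn (fun u => deriv S.βm u * S.decay t) (Ioo t 1) := by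
    rw [← intervalIntegrable_iff_integrableOn_Ioo_of_le ht.2.le]
    refine (S.intervalIntegrable_deriv_βm.mono_set ?_).mul_const _
    rw [uIcc_of_le ht.2.le, uIcc_of_le zero_le_one]
    exact Icc_subset_Icc_left ht.1.le
  rw [intervalIntegrable_iff_integrableOn_Ioo_of_le ht.2.le]
  refine Integrable.mono' hb ?_ ?_
  · refine (measurable_deriv _).aestronglyMeasurable.mul
      ((measurable_gammaMix hmeas k mask).aestronglyMeasurable.mul ?_)
    exact (S.continuousOn_decay.mono (Ioo_subset_Ioo_left ht.1.le)).aestronglyMeasurable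
      measurableSet_Ioo
  · refine (ae_restrict_iff' measurableSet_Ioo).2 (ae_of_all _ fun u hu => ?_)
    have := clusterSource_mem_Icc (S := S) (cl := cl) hC hξ0 hξ1 hnonneg hsum k ht hu
    rw [Real.norm_of_nonneg this.1]
    exact this.2

omit [DecidableEq V] in
theorem hasIntDeriv_revCluster (k : C) : HasIntDeriv (revCluster S cl ξ xθ k) (fun u =>
    S.wordRate u * revCluster S cl ξ xθ k u - deriv S.βm u * gammaMix cl ξ k (xθ u mask)) := by
  have hinv : HasIntDeriv (fun u => (S.decay u)⁻¹) (fun u => S.wordRate u * (S.decay u)⁻¹) := by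
    refine .of_hasDerivAt (fun u hu => ?_) (S.continuousOn_wordRate.mul
      (S.continuousOn_decay.inv₀ fun u _ => (S.decay_pos u).ne'))
    convert! (S.hasDerivAt_decay hu).inv (S.decay_pos u).ne' using 1
    have := (S.decay_pos u).ne'
    field_simp
  refine (hinv.mul (hasIntDeriv_integral_right fun t ht => intervalIntegrable_clusterSource
    (S := S) (cl := cl) hC hξ0 hξ1 hmeas hnonneg hsum k ht)).congr ?_ ?_
  · intro t ht
    simp [revCluster, ht]
  · intro t ht
    have := (S.decay_pos t).ne'
    simp only [revCluster, indicator_of_mem ht]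
    unfold clusterSource
    field_simp
    ring

omit [DecidableEq V] in
-- Comes from `gammaMix ≤ 1` and the monotonicity of `decay`. The upper bound gives the limit `0` at
-- time `1`, which the uniqueness argument for the sum needs; it is useless at time `0`.
theorem revCluster_mem_Icc (k : C) (ht : t ∈ Ioo (0 : ℝ) 1) :
    revCluster S cl ξ xθ k t ∈ Icc 0 (1 - S.βm t) := by
  have hD := S.decay_pos t
  have hi := intervalIntegrable_clusterSource (S := S) (cl := cl) hC hξ0 hξ1 hmeas hnonneg hsum k ht
  have hm := fun u hu => clusterSource_mem_Icc (S := S) (cl := cl) hC hξ0 hξ1 hnonneg hsum k ht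
    (u := u) hu
  simp only [revCluster, indicator_of_mem ht]
  constructor
  · refine mul_nonneg (inv_nonneg.2 hD.le) ?_
    have : ∫ _ in t..1, (0 : ℝ) ≤ ∫ u in t..1, clusterSource S cl ξ xθ k u :=
      intervalIntegral.integral_mono_on_of_le_Ioo ht.2.le (by simp) hi fun u hu => (hm u hu).1
    simpa using this
  · have hb : IntervalIntegrable (fun u => deriv S.βm u * S.decay t) volume t 1 := by
      refine (S.intervalIntegrable_deriv_βm.mono_set ?_).mul_const _
      rw [uIcc_of_le ht.2.le, uIcc_of_le zero_le_one]
      exact Icc_subset_Icc_left ht.1.le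
    have := intervalIntegral.integral_mono_on_of_le_Ioo ht.2.le hi hb fun u hu => (hm u hu).2
    rw [intervalIntegral.integral_mul_const, S.integral_deriv_βm ht] at this
    rwa [inv_mul_le_iff₀ hD, mul_comm]

omit [DecidableEq V] in
-- The sum and `βc` solve the same linear equation with limit `0` at time `1`; the comparison
-- principle with zero source, applied to both differences, makes them equal.
theorem sum_revCluster (ht : t ∈ Ioo (0 : ℝ) 1) : ∑ k, revCluster S cl ξ xθ k t = S.βc t := by
  have hk : ∀ k, Tendsto (revCluster S cl ξ xθ k) (𝓝[<] 1) (𝓝 0) := by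
    intro k
    have hb : Tendsto (fun t => 1 - S.βm t) (𝓝[<] 1) (𝓝 0) := by
      simpa [S.βm_one] using
        (tendsto_nhdsLT_one_of_continuousOn S.continuousOn_βm).const_sub (1 : ℝ)
    refine tendsto_of_tendsto_of_tendsto_of_le_of_le' tendsto_const_nhds hb ?_ ?_ <;>
    filter_upwards [Ioo_mem_nhdsLT (zero_lt_one (α := ℝ))] with u hu
    · exact (revCluster_mem_Icc hC hξ0 hξ1 hmeas hnonneg hsum k hu).1
    · exact (revCluster_mem_Icc hC hξ0 hξ1 hmeas hnonneg hsum k hu).2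
  have hβ : Tendsto S.βc (𝓝[<] 1) (𝓝 0) := by
    simpa [S.βc_one] using tendsto_nhdsLT_one_of_continuousOn S.continuousOn_βc
  have hl : Tendsto (fun t => ∑ k, revCluster S cl ξ xθ k t) (𝓝[<] 1) (𝓝 0) := by
    simpa using tendsto_finsetSum Finset.univ fun k _ => hk k
  have hd : HasIntDeriv (fun t => ∑ k, revCluster S cl ξ xθ k t) (fun u =>
      S.wordRate u * ∑ k, revCluster S cl ξ xθ k u - deriv S.βm u) := by
    refine (HasIntDeriv.sum Finset.univ fun k => hasIntDeriv_revCluster (S := S) (cl := cl)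
      hC hξ0 hξ1 hmeas hnonneg hsum k).congr (fun _ _ => rfl) fun u hu => ?_
    simp only [Finset.sum_sub_distrib, ← Finset.mul_sum, sum_gammaMix hC (hsum u hu mask), mul_one]
  have h1 := S.nonneg_of_hasIntDeriv (g := fun _ => 0)
    (f := fun t => ∑ k, revCluster S cl ξ xθ k t - S.βc t)
    ((hd.sub S.hasIntDeriv_βc).congr (fun _ _ => rfl) fun u hu => by
      linear_combination -S.sum_deriv hu + S.wordRate_mul hu) (fun _ _ => le_rfl)
    (by simpa using hl.sub hβ) ht
  have h2 := S.nonneg_of_hasIntDeriv (g := fun _ => 0)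
    (f := fun t => S.βc t - ∑ k, revCluster S cl ξ xθ k t)
    ((S.hasIntDeriv_βc.sub hd).congr (fun _ _ => rfl) fun u hu => by
      linear_combination S.sum_deriv hu - S.wordRate_mul hu) (fun _ _ => le_rfl)
    (by simpa using hβ.sub hl) ht
  exact le_antisymm (sub_nonneg.1 h2) (sub_nonneg.1 h1)

omit [DecidableEq V] in
theorem revCluster_le (k : C) (ht : t ∈ Ioo (0 : ℝ) 1) : revCluster S cl ξ xθ k t ≤ S.βc t := by
  rw [← sum_revCluster (S := S) (cl := cl) hC hξ0 hξ1 hmeas hnonneg hsum ht]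
  exact Finset.single_le_sum (f := fun k => revCluster S cl ξ xθ k t)
    (fun j _ => (revCluster_mem_Icc hC hξ0 hξ1 hmeas hnonneg hsum j ht).1) (Finset.mem_univ k)

omit [DecidableEq V] in
theorem continuousOn_revCluster (k : C) : ContinuousOn (revCluster S cl ξ xθ k) (Icc 0 1) := by
  refine continuousOn_Icc_zero_one
    (hasIntDeriv_revCluster hC hξ0 hξ1 hmeas hnonneg hsum k).continuousOn ?_ ?_
  · have hβ := tendsto_nhdsGT_zero_of_continuousOn S.continuousOn_βc
    rw [S.βc_zero] at hβ
    have : revCluster S cl ξ xθ k 0 = 0 := by simp [revCluster]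
    rw [this]
    refine tendsto_of_tendsto_of_tendsto_of_le_of_le' tendsto_const_nhds hβ ?_ ?_ <;>
    filter_upwards [Ioo_mem_nhdsGT (zero_lt_one (α := ℝ))] with u hu
    · exact (revCluster_mem_Icc hC hξ0 hξ1 hmeas hnonneg hsum k hu).1
    · exact revCluster_le hC hξ0 hξ1 hmeas hnonneg hsum k hu
  · have hβ := tendsto_nhdsLT_one_of_continuousOn S.continuousOn_βc
    rw [S.βc_one] at hβ
    have : revCluster S cl ξ xθ k 1 = 0 := by simp [revCluster]
    rw [this]
    refine tendsto_of_tendsto_of_tendsto_of_le_of_le' tendsto_const_nhds hβ ?_ ?_ <;>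
    filter_upwards [Ioo_mem_nhdsLT (zero_lt_one (α := ℝ))] with u hu
    · exact (revCluster_mem_Icc hC hξ0 hξ1 hmeas hnonneg hsum k hu).1
    · exact revCluster_le hC hξ0 hξ1 hmeas hnonneg hsum k hu

omit hmeas in
omit [DecidableEq V] in
theorem wordFlow_nonneg {p : C → ℝ} (hp : ∀ k, 0 ≤ p k) (v : V) (ht : t ∈ Ioo (0 : ℝ) 1) :
    0 ≤ wordFlow S cl ξ xθ p v t :=
  Finset.sum_nonneg fun k _ => mul_nonneg (hp k) (mul_nonneg (S.wordRate_nonneg ht)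
    (div_nonneg (mul_nonneg (hnonneg t ht _ v) (gammaPert_pos hC hξ0 hξ1 k v).le)
      (gammaMix_pos hC hξ0 hξ1 (hnonneg t ht _) (hsum t ht _) k).le))

omit hmeas in
omit [DecidableEq V] in
theorem sum_wordFlow (p : C → ℝ) (ht : t ∈ Ioo (0 : ℝ) 1) :
    ∑ v, wordFlow S cl ξ xθ p v t = S.wordRate t * ∑ k, p k := by
  unfold wordFlow
  rw [Finset.sum_comm, Finset.mul_sum]
  refine Finset.sum_congr rfl fun k _ => ?_
  rw [← Finset.mul_sum, ← Finset.mul_sum, ← Finset.sum_div]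
  have hG := gammaMix_pos (cl := cl) hC hξ0 hξ1 (hnonneg t ht (cluster k)) (hsum t ht (cluster k)) k
  change p k * (S.wordRate t * (gammaMix cl ξ k (xθ t (cluster k)) / _)) = _
  rw [div_self hG.ne']
  ring

omit [DecidableEq V] in
theorem sum_wordFlow_revCluster (ht : t ∈ Ioo (0 : ℝ) 1) :
    ∑ v, wordFlow S cl ξ xθ (fun k => revCluster S cl ξ xθ k t) v t = -deriv S.α t := by
  rw [sum_wordFlow hC hξ0 hξ1 hnonneg hsum _ ht, sum_revCluster hC hξ0 hξ1 hmeas hnonneg hsum ht,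
    S.wordRate_mul ht]

omit [DecidableEq V] in
-- The flows are nonnegative and add up to `-α'`, so each is dominated by an integrable function.
theorem intervalIntegrable_wordFlow (v : V) : IntervalIntegrable
    (fun u => wordFlow S cl ξ xθ (fun k => revCluster S cl ξ xθ k u) v u) volume 0 1 := by
  have hb : IntegrableOn (fun u => -deriv S.α u) (Ioo 0 1) := by
    rw [← intervalIntegrable_iff_integrableOn_Ioo_of_le zero_le_one]
    exact S.intervalIntegrable_deriv_α.neg
  rw [intervalIntegrable_iff_integrableOn_Ioo_of_le zero_le_one]
  have hnn : ∀ u ∈ Ioo (0 : ℝ) 1, ∀ v,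
      0 ≤ wordFlow S cl ξ xθ (fun k => revCluster S cl ξ xθ k u) v u := fun u hu v =>
    wordFlow_nonneg hC hξ0 hξ1 hnonneg hsum
      (fun k => (revCluster_mem_Icc hC hξ0 hξ1 hmeas hnonneg hsum k hu).1) v hu
  refine Integrable.mono' hb ?_ ?_
  · unfold wordFlow
    refine Finset.aestronglyMeasurable_fun_sum _ fun k _ => ?_
    refine (((continuousOn_revCluster hC hξ0 hξ1 hmeas hnonneg hsum k).mono
      Ioo_subset_Icc_self).aestronglyMeasurable measurableSet_Ioo).mul
      ((S.continuousOn_wordRate.aestronglyMeasurable measurableSet_Ioo).mul ?_)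
    exact (((hmeas _ v).mul_const _).div (measurable_gammaMix hmeas k _)).aestronglyMeasurable
  · refine (ae_restrict_iff' measurableSet_Ioo).2 (ae_of_all _ fun u hu => ?_)
    rw [Real.norm_of_nonneg (hnn u hu v),
      ← sum_wordFlow_revCluster (S := S) (cl := cl) hC hξ0 hξ1 hmeas hnonneg hsum hu]
    exact Finset.single_le_sum
      (f := fun v => wordFlow S cl ξ xθ (fun k => revCluster S cl ξ xθ k u) v u)
      (fun w _ => hnn u hu w) (Finset.mem_univ v)

theorem hasIntDeriv_revLaw (z : State V C) : HasIntDeriv (fun t => revLaw S cl ξ xθ t z)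
    (fun u => -∑ z', revLaw S cl ξ xθ u z' * backRate S cl ξ xθ u z' z) := by
  obtain v | k | ⟨⟩ := z
  · refine (hasIntDeriv_integral_right fun t ht =>
      (intervalIntegrable_wordFlow (S := S) (cl := cl) hC hξ0 hξ1 hmeas hnonneg hsum v).mono_set
      ?_).congr (fun _ _ => rfl) fun u hu => ?_
    · rw [uIcc_of_le ht.2.le, uIcc_of_le zero_le_one]
      exact Icc_subset_Icc_left ht.1.le
    · rw [sum_mul_backRate_word hu]
      rfl
  · refine (hasIntDeriv_revCluster (S := S) (cl := cl) hC hξ0 hξ1 hmeas hnonneg hsum k).congr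
      (fun _ _ => rfl) fun u hu => ?_
    rw [sum_mul_backRate_cluster hC hξ0 hξ1 hu (hnonneg u hu) (hsum u hu)]
    have := (S.βm_pos u hu).ne'
    simp only [revLaw]
    field_simp
    ring
  · refine S.hasIntDeriv_βm.congr (fun _ _ => rfl) fun u hu => ?_
    have := (S.βm_pos u hu).ne'
    rw [sum_mul_backRate_mask hC hu (hsum u hu _)]
    simp only [revLaw]
    field_simp

theorem isReverseLaw_revLaw : IsReverseLaw S cl ξ xθ (revLaw S cl ξ xθ) where
  nonneg t ht z := by
    obtain v | k | ⟨⟩ := z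
    · have hi := (intervalIntegrable_wordFlow (S := S) (cl := cl) hC hξ0 hξ1 hmeas hnonneg hsum
        v).mono_set (c := t) (d := 1) (by
          rw [uIcc_of_le ht.2, uIcc_of_le zero_le_one]
          exact Icc_subset_Icc_left ht.1)
      have : ∫ _ in t..1, (0 : ℝ) ≤
          ∫ u in t..1, wordFlow S cl ξ xθ (fun k => revCluster S cl ξ xθ k u) v u :=
        intervalIntegral.integral_mono_on_of_le_Ioo ht.2 (by simp) hi fun u hu =>
          have hu' : u ∈ Ioo (0 : ℝ) 1 := ⟨ht.1.trans_lt hu.1, hu.2⟩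
          wordFlow_nonneg hC hξ0 hξ1 hnonneg hsum
            (fun k => (revCluster_mem_Icc hC hξ0 hξ1 hmeas hnonneg hsum k hu').1) v hu'
      rw [intervalIntegral.integral_zero] at this
      exact this
    · by_cases h : t ∈ Ioo (0 : ℝ) 1
      · exact (revCluster_mem_Icc hC hξ0 hξ1 hmeas hnonneg hsum k h).1
      · simp [revLaw, revCluster, indicator_of_notMem h]
    · exact S.βm_nonneg ht
  sum_eq_one t ht := by
    have hc : ∑ k, revCluster S cl ξ xθ k t = S.βc t := by
      obtain rfl | h0 := ht.1.eq_or_lt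
      · simp [revCluster, S.βc_zero]
      obtain rfl | h1 := ht.2.eq_or_lt
      · simp [revCluster, S.βc_one]
      · exact sum_revCluster hC hξ0 hξ1 hmeas hnonneg hsum ⟨h0, h1⟩
    have hw : ∑ v, ∫ u in t..1, wordFlow S cl ξ xθ (fun k => revCluster S cl ξ xθ k u) v u =
        S.α t := by
      rw [← intervalIntegral.integral_finsetSum fun v _ =>
        (intervalIntegrable_wordFlow (S := S) (cl := cl) hC hξ0 hξ1 hmeas hnonneg hsum
          v).mono_set (c := t) (d := 1) (by
            rw [uIcc_of_le ht.2, uIcc_of_le zero_le_one]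
            exact Icc_subset_Icc_left ht.1)]
      rw [← neg_neg (S.α t), ← S.integral_deriv_α ht, ← intervalIntegral.integral_neg,
        intervalIntegral.integral_of_le ht.2, intervalIntegral.integral_of_le ht.2,
        integral_Ioc_eq_integral_Ioo, integral_Ioc_eq_integral_Ioo]
      exact setIntegral_congr_fun measurableSet_Ioo fun u hu =>
        sum_wordFlow_revCluster hC hξ0 hξ1 hmeas hnonneg hsum ⟨ht.1.trans_lt hu.1, hu.2⟩
    rw [sum_state]
    simp only [revLaw, hc, hw]
    linarith [S.sum_eq_one t ht]
  start z := by
    obtain v | k | ⟨⟩ := z <;> simp [revLaw, revCluster, S.βm_one]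
  continuousOn z := by
    obtain v | k | ⟨⟩ := z
    · have := ((intervalIntegrable_wordFlow (S := S) (cl := cl) hC hξ0 hξ1 hmeas hnonneg hsum
        v).absolutelyContinuousOnInterval_intervalIntegral (c := 1) right_mem_uIcc).continuousOn.neg
      rw [uIcc_of_le zero_le_one] at this
      refine this.congr fun t _ => ?_
      exact intervalIntegral.integral_symm _ _
    · exact continuousOn_revCluster hC hξ0 hξ1 hmeas hnonneg hsum k
    · exact S.continuousOn_βm
  integrable s t hs hst ht z := by
    exact (hasIntDeriv_revLaw (S := S) (cl := cl) hC hξ0 hξ1 hmeas hnonneg hsum z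
      s t hs hst ht).1.neg.congr fun u _ => neg_neg _
  master s t hs hst ht z := by
    have := (hasIntDeriv_revLaw (S := S) (cl := cl) hC hξ0 hξ1 hmeas hnonneg hsum z
      s t hs hst ht).2
    rw [intervalIntegral.integral_neg] at this
    linarith

end Existence

/-! ### The bound on the log-likelihood. -/

/-- The pointwise inequality behind the bound on the log-likelihood: two applications of
`log r ≤ r - 1`. -/
theorem elbo_summand_le {a b g G R w P : ℝ} (ha : a ≤ 0) (hb : 0 ≤ b) (hg : 0 < g)
    (hG : 0 < G) (hR : 0 < R) (hw : 0 < w) (hP : 0 < P) :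
    -a * (g * Real.log R) + b * (g * Real.log (G / g)) ≤
      g * (-a * (Real.log P - 1)) + -a * (g * w * R) / P
        - g * (-(a + b) * Real.log w + b * (1 - G / g / w)) := by
  have h1 : Real.log R ≤ Real.log P - 1 - Real.log w + w * R / P := by
    have h := Real.log_le_sub_one_of_pos (div_pos (mul_pos hw hR) hP)
    rw [Real.log_div (mul_pos hw hR).ne' hP.ne', Real.log_mul hw.ne' hR.ne'] at h
    linarith
  have h2 : Real.log (G / g) ≤ G / g / w - 1 + Real.log w := by
    have h := Real.log_le_sub_one_of_pos (div_pos (div_pos hG hg) hw)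
    rw [Real.log_div (div_pos hG hg).ne' hw.ne'] at h
    linarith
  have h1' := mul_le_mul_of_nonneg_left h1 (mul_nonneg (neg_nonneg.2 ha) hg.le)
  have h2' := mul_le_mul_of_nonneg_left h2 (mul_nonneg hb hg.le)
  calc _ = -a * g * Real.log R + b * g * Real.log (G / g) := by ring
    _ ≤ _ := add_le_add h1' h2'
    _ = _ := by ring

section Elbo

variable {V C : Type*} [Fintype V] [DecidableEq V] [Fintype C] [DecidableEq C]
variable {S : Schedule} {cl : V → C} {ξ t : ℝ} {xθ : ℝ → State V C → V → ℝ} {x : V}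

/-- The mean of the closed form over the forward marginal at a fixed time. -/
noncomputable def elboDensity (S : Schedule) (cl : V → C) (ξ : ℝ)
    (xθ : ℝ → State V C → V → ℝ) (x : V) (t : ℝ) : ℝ :=
  -deriv S.α t * ∑ k, gammaPert cl ξ k x * Real.log
      (xθ t (cluster k) x * gammaPert cl ξ k x / gammaMix cl ξ k (xθ t (cluster k)))
    + deriv S.βm t * ∑ k, gammaPert cl ξ k x *
      Real.log (gammaMix cl ξ k (xθ t mask) / gammaPert cl ξ k x)

omit [DecidableEq V] in
theorem measurable_elboDensity (hmeas : ∀ z v, Measurable (fun t => xθ t z v)) :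
    Measurable (elboDensity S cl ξ xθ x) := by
  refine ((measurable_deriv _).neg.mul (Finset.measurable_fun_sum _ fun k _ => ?_)).add
    ((measurable_deriv _).mul (Finset.measurable_fun_sum _ fun k _ => ?_))
  · exact ((((hmeas _ x).mul_const _).div (measurable_gammaMix hmeas k _)).log).const_mul _
  · exact (((measurable_gammaMix hmeas k _).div_const _).log).const_mul _

variable (hC : 2 ≤ Fintype.card C) (hξ0 : 0 < ξ) (hξ1 : ξ < 1)
    (hnonneg : ∀ t ∈ Ioo (0 : ℝ) 1, ∀ z v, 0 ≤ xθ t z v)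
    (hsum : ∀ t ∈ Ioo (0 : ℝ) 1, ∀ z, ∑ v, xθ t z v = 1)
include hC hξ0 hξ1 hnonneg hsum

theorem elboDensity_nonpos (ht : t ∈ Ioo (0 : ℝ) 1) : elboDensity S cl ξ xθ x t ≤ 0 := by
  unfold elboDensity
  rw [← sum_marginal_mul_closedTerm hC hξ0 hξ1 ht (hsum t ht)]
  refine Finset.sum_nonpos fun z _ => mul_nonpos_of_nonneg_of_nonpos ?_
    (closedTerm_nonpos hC hξ0 hξ1 ht (hnonneg t ht) (hsum t ht) z)
  obtain v | k | ⟨⟩ := z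
  · simp only [marginal]
    split_ifs
    exacts [(S.α_pos t ht).le, le_rfl]
  · exact mul_nonneg (S.βc_pos t ht).le (gammaPert_pos hC hξ0 hξ1 k x).le
  · exact (S.βm_pos t ht).le

namespace IsReverseLaw

variable {p : ℝ → State V C → ℝ} (hp : IsReverseLaw S cl ξ xθ p)
include hp

theorem cluster_pos (k : C) (ht : t ∈ Ioo (0 : ℝ) 1) : 0 < p t (cluster k) :=
  (mul_pos (gammaMin_pos hC hξ0 hξ1) (S.βc_pos t ht)).trans_le
    (hp.cluster_mem_Icc hC hξ0 hξ1 hnonneg hsum k ht).1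

omit hC hξ0 hξ1 hnonneg hsum in
theorem hasIntDeriv_word (v : V) : HasIntDeriv (fun t => p t (word v))
    (fun u => -wordFlow S cl ξ xθ (fun k => p u (cluster k)) v u) :=
  (hp.hasIntDeriv (word v)).congr (fun _ _ => rfl) fun u hu => by rw [sum_mul_backRate_word hu]

/-- The ratio of the cluster probabilities of the reverse and the forward process. -/
theorem hasIntDeriv_ratio (k : C) :
    HasIntDeriv (fun u => p u (cluster k) / (S.βc u * gammaPert cl ξ k x)) (fun u =>
      deriv S.βm u / S.βc u * (p u (cluster k) / (S.βc u * gammaPert cl ξ k x)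
        - gammaMix cl ξ k (xθ u mask) / gammaPert cl ξ k x)) := by
  have hinv : HasIntDeriv (fun u => (S.βc u)⁻¹) (fun u => -deriv S.βc u / S.βc u ^ 2) := by
    refine .of_hasDerivAt (fun u hu => (S.hasDerivAt_βc hu).inv (S.βc_pos u hu).ne') ?_
    exact S.continuousOn_deriv_βc.neg.div ((S.continuousOn_βc.mono Ioo_subset_Icc_self).pow 2)
      fun u hu => (pow_pos (S.βc_pos u hu) 2).ne'
  have hg := (gammaPert_pos (cl := cl) hC hξ0 hξ1 k x).ne'
  refine (((hp.hasIntDeriv_cluster hC hξ0 hξ1 hnonneg hsum k).mul hinv).const_mul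
    (gammaPert cl ξ k x)⁻¹).congr (fun u hu => ?_) fun u hu => ?_
  · have := (S.βc_pos u hu).ne'
    field_simp
  · have := (S.βc_pos u hu).ne'
    have hw := S.wordRate_mul hu
    have hs := S.sum_deriv hu
    have hd : deriv S.βc u = S.wordRate u * S.βc u - deriv S.βm u := by linarith
    rw [hd]
    field_simp
    ring

/-- Bounds uniform in time keep the logarithm of the ratio bounded, so that `βc` times it vanishes
at both endpoints. -/
theorem ratio_mem_Icc (k : C) (ht : t ∈ Ioo (0 : ℝ) 1) :
    p t (cluster k) / (S.βc t * gammaPert cl ξ k x) ∈ Icc (gammaMin C ξ) (gammaMin C ξ)⁻¹ := by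
  have hm := gammaMin_pos hC hξ0 hξ1
  have hg := gammaPert_pos (cl := cl) hC hξ0 hξ1 k x
  have hg1 := gammaPert_le_one (cl := cl) hC hξ0 hξ1 k x
  have hgm : gammaMin C ξ ≤ gammaPert cl ξ k x := gammaMin_le k x
  have hβ := S.βc_pos t ht
  obtain ⟨h1, h2⟩ := hp.cluster_mem_Icc hC hξ0 hξ1 hnonneg hsum k ht
  constructor
  · rw [le_div_iff₀ (mul_pos hβ hg)]
    refine le_trans ?_ h1
    rw [← mul_assoc]
    exact mul_le_of_le_one_right (mul_pos hm hβ).le hg1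
  · rw [div_le_iff₀ (mul_pos hβ hg), inv_mul_eq_div, le_div_iff₀ hm]
    exact mul_le_mul h2 hgm hm.le hβ.le

theorem hasIntDeriv_mul_log_ratio (k : C) :
    HasIntDeriv (fun u => S.βc u * Real.log (p u (cluster k) / (S.βc u * gammaPert cl ξ k x)))
      (fun u => deriv S.βc u * Real.log (p u (cluster k) / (S.βc u * gammaPert cl ξ k x))
        + deriv S.βm u * (1 - gammaMix cl ξ k (xθ u mask) / gammaPert cl ξ k x
          / (p u (cluster k) / (S.βc u * gammaPert cl ξ k x)))) := by
  have hpos : ∀ u ∈ Ioo (0 : ℝ) 1, 0 < p u (cluster k) / (S.βc u * gammaPert cl ξ k x) :=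
    fun u hu => (gammaMin_pos hC hξ0 hξ1).trans_le
      (hp.ratio_mem_Icc hC hξ0 hξ1 hnonneg hsum k hu).1
  refine (S.hasIntDeriv_βc.mul ((hp.hasIntDeriv_ratio hC hξ0 hξ1 hnonneg hsum
    k).log hpos)).congr (fun _ _ => rfl) fun u hu => ?_
  have := (S.βc_pos u hu).ne'
  have hw := (hpos u hu).ne'
  set w := p u (cluster k) / (S.βc u * gammaPert cl ξ k x)
  field_simp

theorem abs_mul_log_ratio_le (k : C) (ht : t ∈ Ioo (0 : ℝ) 1) :
    ‖S.βc t * Real.log (p t (cluster k) / (S.βc t * gammaPert cl ξ k x))‖ ≤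
      S.βc t * -Real.log (gammaMin C ξ) := by
  have hm := gammaMin_pos hC hξ0 hξ1
  obtain ⟨h1, h2⟩ := hp.ratio_mem_Icc (x := x) hC hξ0 hξ1 hnonneg hsum k ht
  have hβ := S.βc_pos t ht
  rw [Real.norm_eq_abs, abs_mul, abs_of_pos hβ]
  refine mul_le_mul_of_nonneg_left (abs_le.2 ⟨?_, ?_⟩) hβ.le
  · rw [neg_neg]
    exact Real.log_le_log hm h1
  · rw [← Real.log_inv]
    exact Real.log_le_log (hm.trans_le h1) h2

theorem tendsto_mul_log_ratio_zero (k : C) :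
    Tendsto (fun u => S.βc u * Real.log (p u (cluster k) / (S.βc u * gammaPert cl ξ k x)))
      (𝓝[>] 0) (𝓝 0) := by
  have hβ := (tendsto_nhdsGT_zero_of_continuousOn S.continuousOn_βc).mul_const
    (-Real.log (gammaMin C ξ))
  rw [S.βc_zero, zero_mul] at hβ
  refine squeeze_zero_norm' ?_ hβ
  filter_upwards [Ioo_mem_nhdsGT (zero_lt_one (α := ℝ))] with u hu
  exact hp.abs_mul_log_ratio_le hC hξ0 hξ1 hnonneg hsum k hu

theorem tendsto_mul_log_ratio_one (k : C) :
    Tendsto (fun u => S.βc u * Real.log (p u (cluster k) / (S.βc u * gammaPert cl ξ k x)))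
      (𝓝[<] 1) (𝓝 0) := by
  have hβ := (tendsto_nhdsLT_one_of_continuousOn S.continuousOn_βc).mul_const
    (-Real.log (gammaMin C ξ))
  rw [S.βc_one, zero_mul] at hβ
  refine squeeze_zero_norm' ?_ hβ
  filter_upwards [Ioo_mem_nhdsLT (zero_lt_one (α := ℝ))] with u hu
  exact hp.abs_mul_log_ratio_le hC hξ0 hξ1 hnonneg hsum k hu

variable (hxc : ∀ t ∈ Ioo (0 : ℝ) 1, ∀ k, 0 < xθ t (cluster k) x)
include hxc

/-- The mass of `x` only grows in reverse time. If it were `0` at the end, it would be `0`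
throughout, so the flow into `x` would vanish almost everywhere. All factors of that flow except
`wordRate` are positive, so `α'` would vanish almost everywhere, against `α 0 = 1` and `α 1 = 0`. -/
theorem word_zero_pos : 0 < p 0 (word x) := by
  have h01 : (0 : ℝ) ∈ Icc (0 : ℝ) 1 := by simp
  by_contra hcon
  have hP : p 0 (word x) = 0 := le_antisymm (not_lt.1 hcon) (hp.nonneg 0 h01 _)
  have hd := hp.hasIntDeriv_word x
  have hflow : ∀ u ∈ Ioo (0 : ℝ) 1, 0 ≤ wordFlow S cl ξ xθ (fun k => p u (cluster k)) x u :=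
    fun u hu => wordFlow_nonneg hC hξ0 hξ1 hnonneg hsum
      (fun k => (hp.cluster_pos hC hξ0 hξ1 hnonneg hsum k hu).le) x hu
  have hz : ∀ s ∈ Ioo (0 : ℝ) 1, p s (word x) = 0 := by
    intro s hs
    refine le_antisymm ?_ (hp.nonneg s (Ioo_subset_Icc_self hs) _)
    rw [← hP]
    refine ge_of_tendsto (tendsto_nhdsGT_zero_of_continuousOn (hp.continuousOn (word x))) ?_
    filter_upwards [Ioo_mem_nhdsGT hs.1] with u hu
    exact hd.le_of_nonpos (fun v hv => neg_nonpos.2 (hflow v hv)) hu.1 hu.2.le hs.2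
  have hα : ∀ s t, 0 < s → s ≤ t → t < 1 → S.α s = S.α t := by
    intro s t hs hst ht
    have hsub : ∀ u ∈ Ioc s t, u ∈ Ioo (0 : ℝ) 1 := fun u hu =>
      ⟨hs.trans hu.1, hu.2.trans_lt ht⟩
    obtain ⟨hi, he⟩ := hd s t hs hst ht
    simp only [intervalIntegral.integral_neg, hz t ⟨hs.trans_le hst, ht⟩,
      hz s ⟨hs, hst.trans_lt ht⟩, sub_zero, neg_eq_zero] at he
    have hi' : IntervalIntegrable (fun u => wordFlow S cl ξ xθ (fun k => p u (cluster k)) x u)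
      volume s t := hi.neg.congr fun u _ => neg_neg _
    rw [intervalIntegral.integral_eq_zero_iff_of_le_of_nonneg_ae hst
      ((ae_restrict_iff' measurableSet_Ioc).2 (ae_of_all _ fun u hu => hflow u (hsub u hu))) hi'] at he
    obtain ⟨-, he'⟩ := S.hasIntDeriv_α s t hs hst ht
    have h0 : ∫ u in s..t, deriv S.α u = 0 := by
      refine intervalIntegral.integral_zero_ae ?_
      rw [uIoc_of_le hst]
      filter_upwards [(ae_restrict_iff' measurableSet_Ioc).1 he] with u hu hu'
      have hu01 := hsub u hu'
      have hnn : ∀ k ∈ Finset.univ, 0 ≤ p u (cluster k) * (S.wordRate u *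
          (xθ u (cluster k) x * gammaPert cl ξ k x / gammaMix cl ξ k (xθ u (cluster k)))) :=
        fun k _ => mul_nonneg (hp.cluster_pos hC hξ0 hξ1 hnonneg hsum k hu01).le
          (mul_nonneg (S.wordRate_nonneg hu01) (div_nonneg (mul_nonneg (hnonneg u hu01 _ x)
            (gammaPert_pos hC hξ0 hξ1 k x).le)
            (gammaMix_pos hC hξ0 hξ1 (hnonneg u hu01 _) (hsum u hu01 _) k).le))
      have hk := (Finset.sum_eq_zero_iff_of_nonneg hnn).1 (hu hu') (cl x) (Finset.mem_univ _)
      have h1 := (hp.cluster_pos hC hξ0 hξ1 hnonneg hsum (cl x) hu01).ne'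
      have h2 := (div_pos (mul_pos (hxc u hu01 (cl x)) (gammaPert_pos (cl := cl) hC hξ0 hξ1 (cl x) x))
        (gammaMix_pos (cl := cl) hC hξ0 hξ1 (hnonneg u hu01 (cluster (cl x))) (hsum u hu01 _)
          (cl x))).ne'
      have h3 : S.wordRate u = 0 := by
        rcases mul_eq_zero.1 hk with h | h
        · exact absurd h h1
        · exact (mul_eq_zero.1 h).resolve_right h2
      have := S.wordRate_mul hu01
      rw [h3, zero_mul] at this
      linarith
    linarith
  have h2 : (1 / 2 : ℝ) ∈ Ioo (0 : ℝ) 1 := by norm_num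
  have ha : S.α (1 / 2) = S.α 0 := by
    refine tendsto_nhds_unique (tendsto_const_nhds.congr' ?_)
      (tendsto_nhdsGT_zero_of_continuousOn S.continuousOn_α)
    filter_upwards [Ioo_mem_nhdsGT h2.1] with u hu
    exact (hα u (1 / 2) hu.1 hu.2.le h2.2).symm
  have hb : S.α (1 / 2) = S.α 1 := by
    refine tendsto_nhds_unique (tendsto_const_nhds.congr' ?_)
      (tendsto_nhdsLT_one_of_continuousOn S.continuousOn_α)
    filter_upwards [Ioo_mem_nhdsLT h2.2] with u hu
    exact hα (1 / 2) u h2.1 hu.1.le hu.2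
  rw [S.α_zero] at ha
  rw [S.α_one] at hb
  linarith

/-- The right-hand side is the derivative of the function `Ψ` introduced in `closedElbo_le`.
Summation over `k` uses `∑ k, gammaPert cl ξ k x = 1` for the `α` term and recovers `wordFlow` from
the terms with `w * R`. -/
theorem elboDensity_le (ht : t ∈ Ioo (0 : ℝ) 1) :
    elboDensity S cl ξ xθ x t ≤
      -(Real.log (p 0 (word x)) - 1) * deriv S.α t
        - (p 0 (word x))⁻¹ * -wordFlow S cl ξ xθ (fun k => p t (cluster k)) x t
        - ∑ k, gammaPert cl ξ k x *
          (deriv S.βc t * Real.log (p t (cluster k) / (S.βc t * gammaPert cl ξ k x))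
            + deriv S.βm t * (1 - gammaMix cl ξ k (xθ t mask) / gammaPert cl ξ k x
              / (p t (cluster k) / (S.βc t * gammaPert cl ξ k x)))) := by
  have hP := hp.word_zero_pos hC hξ0 hξ1 hnonneg hsum hxc
  have hβ := S.βc_pos t ht
  have hd : deriv S.βc t = -(deriv S.α t + deriv S.βm t) := by linarith [S.sum_deriv ht]
  unfold elboDensity
  rw [Finset.mul_sum, Finset.mul_sum, ← Finset.sum_add_distrib]
  refine (Finset.sum_le_sum fun k _ => elbo_summand_le (S.deriv_α_nonpos t ht)
    (S.deriv_βm_nonneg t ht) (gammaPert_pos hC hξ0 hξ1 k x)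
    (gammaMix_pos hC hξ0 hξ1 (hnonneg t ht _) (hsum t ht _) k)
    (div_pos (mul_pos (hxc t ht k) (gammaPert_pos hC hξ0 hξ1 k x))
      (gammaMix_pos hC hξ0 hξ1 (hnonneg t ht _) (hsum t ht _) k))
    ((gammaMin_pos hC hξ0 hξ1).trans_le
      (hp.ratio_mem_Icc (x := x) hC hξ0 hξ1 hnonneg hsum k ht).1) hP).trans_eq ?_
  rw [Finset.sum_sub_distrib, Finset.sum_add_distrib, ← Finset.sum_mul, sum_gammaPert hC, hd]
  congr 1
  rw [sub_eq_add_neg]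
  congr 1
  · ring
  · unfold wordFlow
    rw [mul_neg, neg_neg, Finset.mul_sum]
    refine Finset.sum_congr rfl fun k _ => ?_
    have hg := (gammaPert_pos (cl := cl) hC hξ0 hξ1 k x).ne'
    rw [← S.wordRate_mul ht]
    field_simp

/-- The closed form bounds the log-likelihood of any reverse law from below. -/
theorem closedElbo_le (hmeas : ∀ z v, Measurable (fun t => xθ t z v)) :
    closedElbo S cl ξ xθ x ≤ ENNReal.log (ENNReal.ofReal (p 0 (word x))) := by
  have hP := hp.word_zero_pos hC hξ0 hξ1 hnonneg hsum hxc
  rw [ENNReal.log_ofReal_of_pos hP]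
  have hM : ∀ t ∈ Ioo (0 : ℝ) 1, ∑ z, marginal S cl ξ t x z * closedTerm S cl ξ xθ x t z =
      elboDensity S cl ξ xθ x t := fun t ht =>
    sum_marginal_mul_closedTerm hC hξ0 hξ1 ht (hsum t ht)
  have hMn : ∀ t ∈ Ioo (0 : ℝ) 1, elboDensity S cl ξ xθ x t ≤ 0 := fun t ht =>
    elboDensity_nonpos hC hξ0 hξ1 hnonneg hsum ht
  have hpos : ∫⁻ t in Ioo (0 : ℝ) 1, ENNReal.ofReal
      (∑ z, marginal S cl ξ t x z * closedTerm S cl ξ xθ x t z) = 0 := by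
    rw [setLIntegral_congr_fun (g := fun _ => 0) measurableSet_Ioo fun t ht => by
      rw [hM t ht, ENNReal.ofReal_of_nonpos (hMn t ht)]]
    simp
  have hneg : ∫⁻ t in Ioo (0 : ℝ) 1, ENNReal.ofReal
      (-∑ z, marginal S cl ξ t x z * closedTerm S cl ξ xθ x t z) =
      ∫⁻ t in Ioo (0 : ℝ) 1, ENNReal.ofReal (-elboDensity S cl ξ xθ x t) :=
    setLIntegral_congr_fun measurableSet_Ioo fun t ht => by simp only [hM t ht]
  unfold closedElbo extMean
  rw [hpos, hneg, EReal.coe_ennreal_zero, zero_sub]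
  have hae : 0 ≤ᵐ[volume.restrict (Ioo (0 : ℝ) 1)] fun t => -elboDensity S cl ξ xθ x t :=
    (ae_restrict_iff' measurableSet_Ioo).2 (ae_of_all _ fun t ht => neg_nonneg.2 (hMn t ht))
  have hms : AEStronglyMeasurable (fun t => -elboDensity S cl ξ xθ x t)
      (volume.restrict (Ioo (0 : ℝ) 1)) := (measurable_elboDensity hmeas).neg.aestronglyMeasurable
  -- If the negative part has infinite integral, the left-hand side is `⊥`; from here on the density
  -- may be taken integrable.
  by_cases htop : ∫⁻ t in Ioo (0 : ℝ) 1, ENNReal.ofReal (-elboDensity S cl ξ xθ x t) = ⊤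
  · simp [htop]
  have hint := (lintegral_ofReal_ne_top_iff_integrable hms hae).1 htop
  rw [← ofReal_integral_eq_lintegral_ofReal hint hae, EReal.coe_ennreal_ofReal,
    max_eq_left (integral_nonneg_of_ae hae), ← EReal.coe_neg, EReal.coe_le_coe_iff]
  -- At time `1` every term vanishes. At time `0` the first two give `-(log P - 1) - 1 = -log P`,
  -- with `P = p 0 (word x)`.
  set Ψ : ℝ → ℝ := fun u => -(Real.log (p 0 (word x)) - 1) * S.α u
    - (p 0 (word x))⁻¹ * p u (word x)
    - ∑ k, gammaPert cl ξ k x *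
      (S.βc u * Real.log (p u (cluster k) / (S.βc u * gammaPert cl ξ k x)))
  have hΨ := ((S.hasIntDeriv_α.const_mul (-(Real.log (p 0 (word x)) - 1))).sub
    ((hp.hasIntDeriv_word x).const_mul (p 0 (word x))⁻¹)).sub
    (HasIntDeriv.sum Finset.univ fun k => (hp.hasIntDeriv_mul_log_ratio (x := x)
      hC hξ0 hξ1 hnonneg hsum k).const_mul (gammaPert cl ξ k x))
  have key : ∀ s t, 0 < s → s ≤ t → t < 1 →
      -∫ u in Ioo (0 : ℝ) 1, -elboDensity S cl ξ xθ x u ≤ Ψ t - Ψ s := by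
    intro s t hs hst ht
    obtain ⟨hi, he⟩ := hΨ s t hs hst ht
    have hsub : Ioc s t ⊆ Ioo (0 : ℝ) 1 := fun u hu => ⟨hs.trans hu.1, hu.2.trans_lt ht⟩
    have hM' : IntervalIntegrable (elboDensity S cl ξ xθ x) volume s t := by
      rw [intervalIntegrable_iff_integrableOn_Ioc_of_le hst]
      simpa using (IntegrableOn.mono_set hint hsub).neg
    -- As the density is nonpositive, its integral over `(0, 1)` is at most that over any
    -- subinterval, so the endpoints, where `Ψ'` may be singular, are avoided until the limits are
    -- taken.
    have h1 : ∫ u in Ioc s t, -elboDensity S cl ξ xθ x u ≤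
        ∫ u in Ioo (0 : ℝ) 1, -elboDensity S cl ξ xθ x u :=
      setIntegral_mono_set hint hae (LE.le.eventuallyLE hsub)
    rw [integral_neg, ← intervalIntegral.integral_of_le hst] at h1
    have h2 := intervalIntegral.integral_mono_on_of_le_Ioo hst hM' hi fun u hu =>
      hp.elboDensity_le hC hξ0 hξ1 hnonneg hsum hxc ⟨hs.trans hu.1, hu.2.trans ht⟩
    rw [he] at h2
    change _ ≤ Ψ t - Ψ s at h2
    linarith
  have hΨ1 : Tendsto Ψ (𝓝[<] 1) (𝓝 0) := by
    have h1 := (tendsto_nhdsLT_one_of_continuousOn S.continuousOn_α).const_mul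
      (-(Real.log (p 0 (word x)) - 1))
    have h2 := (tendsto_nhdsLT_one_of_continuousOn (hp.continuousOn (word x))).const_mul
      (p 0 (word x))⁻¹
    have h3 := tendsto_finsetSum Finset.univ fun k _ => (hp.tendsto_mul_log_ratio_one (x := x)
      hC hξ0 hξ1 hnonneg hsum k).const_mul (gammaPert cl ξ k x)
    convert! (h1.sub h2).sub h3 using 2
    simp [S.α_one, hp.start]
  have hΨ0 : Tendsto Ψ (𝓝[>] 0) (𝓝 (-Real.log (p 0 (word x)))) := by
    have h1 := (tendsto_nhdsGT_zero_of_continuousOn S.continuousOn_α).const_mul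
      (-(Real.log (p 0 (word x)) - 1))
    have h2 := (tendsto_nhdsGT_zero_of_continuousOn (hp.continuousOn (word x))).const_mul
      (p 0 (word x))⁻¹
    have h3 := tendsto_finsetSum Finset.univ fun k _ => (hp.tendsto_mul_log_ratio_zero (x := x)
      hC hξ0 hξ1 hnonneg hsum k).const_mul (gammaPert cl ξ k x)
    convert! (h1.sub h2).sub h3 using 2
    simp [S.α_zero, inv_mul_cancel₀ hP.ne']
  -- First `t → 1` with `s` fixed, then `s → 0`.
  have key' : ∀ s ∈ Ioo (0 : ℝ) 1,
      -∫ u in Ioo (0 : ℝ) 1, -elboDensity S cl ξ xθ x u ≤ 0 - Ψ s := by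
    intro s hs
    refine ge_of_tendsto (hΨ1.sub_const (Ψ s)) ?_
    filter_upwards [Ioo_mem_nhdsLT hs.2] with t ht using key s t hs.1 ht.1.le ht.2
  have hlim := hΨ0.const_sub 0
  rw [zero_sub, neg_neg] at hlim
  refine ge_of_tendsto hlim ?_
  filter_upwards [Ioo_mem_nhdsGT (zero_lt_one (α := ℝ))] with s hs using key' s hs

end IsReverseLaw

end Elbo

end HDLM

/-! ### The main theorem. -/

theorem mainTheorem3 {V C : Type*} [Fintype V] [DecidableEq V] [Fintype C] [DecidableEq C]
    (S : HDLM.Schedule) (cl : V → C) (hC : 2 ≤ Fintype.card C)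
    (ξ : ℝ) (hξ0 : 0 < ξ) (hξ1 : ξ < 1)
    (xθ : ℝ → HDLM.State V C → V → ℝ)
    (hmeas : ∀ z v, Measurable (fun t => xθ t z v))
    (hnonneg : ∀ t ∈ Set.Ioo (0 : ℝ) 1, ∀ z v, 0 ≤ xθ t z v)
    (hsum : ∀ t ∈ Set.Ioo (0 : ℝ) 1, ∀ z, ∑ v, xθ t z v = 1)
    (x : V)
    (hxm : ∀ t ∈ Set.Ioo (0 : ℝ) 1, 0 < xθ t HDLM.mask x)
    (hxc : ∀ t ∈ Set.Ioo (0 : ℝ) 1, ∀ k, 0 < xθ t (HDLM.cluster k) x) :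
    -- the reverse process exists, and the closed form bounds its log-likelihood from below
    (∃ p, HDLM.IsReverseLaw S cl ξ xθ p) ∧
    (∀ p, HDLM.IsReverseLaw S cl ξ xθ p →
      HDLM.closedElbo S cl ξ xθ x ≤ ENNReal.log (ENNReal.ofReal (p 0 (HDLM.word x)))) ∧
    -- the integrand is nonpositive, so its expectation is unambiguous in `[-∞, 0]`
    (∀ t ∈ Set.Ioo (0 : ℝ) 1, ∀ z, HDLM.closedTerm S cl ξ xθ x t z ≤ 0) ∧
    -- the closed form is the continuous-time ELBO given by the rates
    (∀ t ∈ Set.Ioo (0 : ℝ) 1,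
      ∑ z, HDLM.marginal S cl ξ t x z * HDLM.rateElboTerm S cl ξ xθ x t z =
        ∑ z, HDLM.marginal S cl ξ t x z * HDLM.closedTerm S cl ξ xθ x t z) ∧
    HDLM.rateElbo S cl ξ xθ x = HDLM.closedElbo S cl ξ xθ x ∧
    -- the form in terms of `η`
    (∀ t ∈ Set.Ioo (0 : ℝ) 1, ∀ z, HDLM.closedTerm S cl ξ xθ x t z =
      HDLM.closedTermEta S cl ξ (((Fintype.card C : ℝ) - 1) * ξ / (1 - ξ)) xθ x t z) ∧
    HDLM.closedElbo S cl ξ xθ x =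
      HDLM.closedElboEta S cl ξ (((Fintype.card C : ℝ) - 1) * ξ / (1 - ξ)) xθ x ∧
    -- reduction to the ELBO without perturbations at `ξ = 1`, by value and as a limit
    HDLM.closedElbo S cl 1 xθ x = HDLM.stdElbo S cl xθ x ∧
    (∀ t ∈ Set.Ioo (0 : ℝ) 1,
      Filter.Tendsto
        (fun ξ' : ℝ => ∑ z, HDLM.marginal S cl ξ' t x z * HDLM.closedTerm S cl ξ' xθ x t z)
        (nhdsWithin 1 (Set.Iio 1))
        (nhds (∑ z, HDLM.stdMarginal S cl t x z * HDLM.stdTerm S cl xθ x t z))) := by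
  have hel : HDLM.closedElbo S cl 1 xθ x = HDLM.stdElbo S cl xθ x :=
    HDLM.extMean_congr fun t _ => HDLM.sum_marginal_mul_closedTerm_one
  have hrate : ∀ t ∈ Set.Ioo (0 : ℝ) 1,
      ∑ z, HDLM.marginal S cl ξ t x z * HDLM.rateElboTerm S cl ξ xθ x t z =
        ∑ z, HDLM.marginal S cl ξ t x z * HDLM.closedTerm S cl ξ xθ x t z := fun t ht =>
    HDLM.sum_marginal_mul_rateElboTerm hC hξ0 hξ1 ht (hnonneg t ht) (hsum t ht)
  refine ⟨⟨_, HDLM.isReverseLaw_revLaw hC hξ0 hξ1 hmeas hnonneg hsum⟩,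
    fun p hp => hp.closedElbo_le hC hξ0 hξ1 hnonneg hsum hxc hmeas,
    fun t ht z => HDLM.closedTerm_nonpos hC hξ0 hξ1 ht (hnonneg t ht) (hsum t ht) z, hrate,
    HDLM.extMean_congr hrate,
    fun t _ z => HDLM.closedTerm_eq_closedTermEta hC hξ0 hξ1 z,
    HDLM.extMean_congr fun t _ => Finset.sum_congr rfl fun z _ => by
      rw [HDLM.closedTerm_eq_closedTermEta hC hξ0 hξ1 z], hel,
    fun t ht => HDLM.tendsto_sum_marginal_mul_closedTerm hC ht (hnonneg t ht) (hsum t ht)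
      (hxm t ht) (hxc t ht)⟩
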